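/- Let $\mathcal G$ be a locally compact Hausdorff \'etale groupoid with unit space $\mathcal G^{(0)}$ and range and source maps $r,s$. Assume that there is a unit $x\in\mathcal G^{(0)}$ with trivial isotropy group, i.e. $\{g\in\mathcal G:\ r(g)=s(g)=x\}=\{x\}$, and that $\mathcal G$ is minimal, i.e. $s(r^{-1}(y))$ is dense in $\mathcal G^{(0)}$ for every $y\in\mathcal G^{(0)}$. Let $C^*_r(\mathcal G)$ be the reduced groupoid $C^*$-algebra, the completion of the convolution algebra $C_c(\mathcal G)$ in the norm $\|f\|_r=\sup_{x\in\mathcal G^{(0)}}\|\pi_x(f)\|$, where $\pi_x$ is the representation on $\ell^2(s^{-1}(x))$ given by $(\pi_x(f)\psi)(g)=\sum_{r(h)=r(g)}f(h)\psi(h^{-1}g)$, and let $P:C^*_r(\mathcal G)\to C_0(\mathcal G^{(0)})$ be the conditional expectation that extends the restriction map $C_c(\mathcal G)\to C_c(\mathcal G^{(0)})$. A weight on a $C^*$-algebra $A$ is an additive map $\psi:A_+\to[0,\infty]$ with $\psi(\lambda a)=\lambda\psi(a)$ for $\lambda>0$; it is proper when it is non-zero, densely defined (finite on a dense subset of $A_+$)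 and lower semi-continuous. Put $\mathcal N_\psi=\{a\in A:\psi(a^*a)<\infty\}$; a proper weight $\psi$ extends uniquely to a linear functional, again denoted $\psi$, on the span of $\{a^*b:\ a,b\in\mathcal N_\psi\}$. For a (pointwise norm-) continuous one-parameter group $\alpha=(\alpha_t)_{t\in\mathbb R}$ of $*$-automorphisms of $A$ and $\beta\in\mathbb R$, a $\beta$-KMS weight for $\alpha$ is a proper weight $\psi$ with $\psi\circ\alpha_t=\psi$ for all $t$ such that for all $a,b\in\mathcal N_\psi\cap\mathcal N_\psi^*$ there is a continuous bounded function $F$ on the closed strip of all $z\in\mathbb C$ with imaginary part between $0$ and $\beta$, holomorphic in its interior, with $F(t)=\psi(a\alpha_t(b))$ and $F(t+i\beta)=\psi(\alpha_t(b)a)$ for all $t\in\mathbb R$. A weight on $C^*_r(\mathcal G)$ is diagonal when it has the form $a\mapsto\int_{\mathcal G^{(0)}}P(a)\,dm$ for a regular Borel measure $m$ (finite on compact sets) on $\mathcal G^{(0)}$. Let $\alpha$ be a continuous one-parameter group of $*$-automorphisms of $C^*_r(\mathcal G)$, and assume that for some $\beta\in\mathbb R\setminus\{0\}$ there is a diagonal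 $\beta$-KMS weight for $\alpha$. Then $\alpha$ is diagonal: there is a continuous homomorphism $c:\mathcal G\to\mathbb R$ (that is, $c(gh)=c(g)+c(h)$ whenever $s(g)=r(h)$) such that $$\alpha_t(f)(\xi)=e^{itc(\xi)}f(\xi)$$ for all $t\in\mathbb R$, all $f\in C_c(\mathcal G)$ and all $\xi\in\mathcal G$. -/

import Mathlib

open scoped ENNReal CompactlySupported ZeroAtInfty ComplexConjugate

universe u v

/-- An étale topological groupoid with space of arrows `G` and space of units `X`. An arrow `g`
goes from `src g` to `rng g`, the product `mul g h` is defined when `src g = rng h`, and the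
range map is a local homeomorphism. The map `unit` is a homeomorphism onto its image, by which
`X` is identified with the usual unit space inside `G`. -/
structure EtaleGroupoid (G : Type u) (X : Type v) [TopologicalSpace G] [TopologicalSpace X] where
  src : G → X
  rng : G → X
  unit : X → G
  inv : G → G
  mul : (g h : G) → src g = rng h → G
  src_unit : ∀ x, src (unit x) = x
  rng_unit : ∀ x, rng (unit x) = x
  src_inv : ∀ g, src (inv g) = rng g
  rng_inv : ∀ g, rng (inv g) = src g
  src_mul : ∀ g h hgh, src (mul g h hgh) = src h
  rng_mul : ∀ g h hgh, rng (mul g h hgh) = rng g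
  mul_assoc : ∀ g h k (hgh : src g = rng h) (hhk : src h = rng k),
    mul (mul g h hgh) k ((src_mul g h hgh).trans hhk) =
      mul g (mul h k hhk) (hgh.trans (rng_mul h k hhk).symm)
  unit_mul : ∀ g, mul (unit (rng g)) g (src_unit (rng g)) = g
  mul_unit : ∀ g, mul g (unit (src g)) (rng_unit (src g)).symm = g
  mul_inv : ∀ g, mul g (inv g) (rng_inv g).symm = unit (rng g)
  inv_mul : ∀ g, mul (inv g) g (src_inv g) = unit (src g)
  continuous_src : Continuous src
  continuous_unit : Continuous unit
  continuous_inv : Continuous inv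
  continuous_mul : Continuous fun p : {p : G × G // src p.1 = rng p.2} => mul p.1.1 p.1.2 p.2
  isLocalHomeomorph_rng : IsLocalHomeomorph rng

namespace EtaleGroupoid

variable {G : Type u} {X : Type v} [TopologicalSpace G] [TopologicalSpace X]
  (𝒢 : EtaleGroupoid G X)

/-- The fibre of the source map over a unit. -/
abbrev SrcFiber (x : X) : Type u := {g : G // 𝒢.src g = x}

/-- The fibre of the range map over a unit. -/
abbrev RngFiber (x : X) : Type u := {g : G // 𝒢.rng g = x}

/-- The Hilbert space of square-summable functions on the source fibre of a unit. -/
abbrev Hilb (x : X) : Type u := lp (fun _ : 𝒢.SrcFiber x => ℂ) 2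

/-- The product `h⁻¹ g` of two arrows with the same range. -/
def ldiv (h g : G) (e : 𝒢.rng h = 𝒢.rng g) : G := 𝒢.mul (𝒢.inv h) g ((𝒢.src_inv h).trans e)

/-- The product `g k⁻¹` of two arrows with the same source. -/
def rdiv (g k : G) (e : 𝒢.src g = 𝒢.src k) : G := 𝒢.mul g (𝒢.inv k) (e.trans (𝒢.rng_inv k).symm)

theorem continuous_rng : Continuous 𝒢.rng := 𝒢.isLocalHomeomorph_rng.continuous

theorem src_ldiv (h g : G) (e : 𝒢.rng h = 𝒢.rng g) : 𝒢.src (𝒢.ldiv h g e) = 𝒢.src g :=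
  𝒢.src_mul _ _ _

theorem rng_ldiv (h g : G) (e : 𝒢.rng h = 𝒢.rng g) : 𝒢.rng (𝒢.ldiv h g e) = 𝒢.src h :=
  (𝒢.rng_mul _ _ _).trans (𝒢.rng_inv h)

theorem src_rdiv (g k : G) (e : 𝒢.src g = 𝒢.src k) : 𝒢.src (𝒢.rdiv g k e) = 𝒢.rng k :=
  (𝒢.src_mul _ _ _).trans (𝒢.src_inv k)

theorem rng_rdiv (g k : G) (e : 𝒢.src g = 𝒢.src k) : 𝒢.rng (𝒢.rdiv g k e) = 𝒢.rng g :=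
  𝒢.rng_mul _ _ _

theorem mul_congr {g g' h h' : G} (e : 𝒢.src g = 𝒢.rng h) (hg : g = g') (hh : h = h') :
    𝒢.mul g h e = 𝒢.mul g' h' (hg ▸ hh ▸ e) := by
  subst hg hh; rfl

theorem unit_mul' (x : X) (g : G) (e : 𝒢.src (𝒢.unit x) = 𝒢.rng g) :
    𝒢.mul (𝒢.unit x) g e = g := by
  obtain rfl : x = 𝒢.rng g := (𝒢.src_unit x).symm.trans e
  exact 𝒢.unit_mul g

theorem mul_unit' (x : X) (g : G) (e : 𝒢.src g = 𝒢.rng (𝒢.unit x)) :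
    𝒢.mul g (𝒢.unit x) e = g := by
  obtain rfl : x = 𝒢.src g := (𝒢.rng_unit x).symm.trans e.symm
  exact 𝒢.mul_unit g

theorem inv_eq_of_mul (g h : G) (e : 𝒢.src g = 𝒢.rng h) (x : X)
    (H : 𝒢.mul g h e = 𝒢.unit x) : 𝒢.inv g = h := by
  have h1 := 𝒢.mul_assoc (𝒢.inv g) g h (𝒢.src_inv g) e
  rw [𝒢.mul_congr _ (𝒢.inv_mul g) rfl, 𝒢.unit_mul', 𝒢.mul_congr _ rfl H, 𝒢.mul_unit'] at h1
  exact h1.symm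

theorem inv_inv (g : G) : 𝒢.inv (𝒢.inv g) = g :=
  𝒢.inv_eq_of_mul _ _ (𝒢.src_inv g) _ (𝒢.inv_mul g)

theorem mul_ldiv (h g : G) (e : 𝒢.rng h = 𝒢.rng g) :
    𝒢.mul h (𝒢.ldiv h g e) (𝒢.rng_ldiv h g e).symm = g := by
  have h1 := 𝒢.mul_assoc h (𝒢.inv h) g (𝒢.rng_inv h).symm ((𝒢.src_inv h).trans e)
  rw [𝒢.mul_congr _ (𝒢.mul_inv h) rfl, 𝒢.unit_mul'] at h1
  exact h1.symm

theorem rdiv_mul (g k : G) (e : 𝒢.src g = 𝒢.src k) :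
    𝒢.mul (𝒢.rdiv g k e) k (𝒢.src_rdiv g k e) = g := by
  have h1 := 𝒢.mul_assoc g (𝒢.inv k) k (e.trans (𝒢.rng_inv k).symm) (𝒢.src_inv k)
  rw [𝒢.mul_congr _ rfl (𝒢.inv_mul k), 𝒢.mul_unit'] at h1
  exact h1

theorem ldiv_mul (h k : G) (e : 𝒢.src h = 𝒢.rng k) :
    𝒢.ldiv h (𝒢.mul h k e) (𝒢.rng_mul h k e).symm = k := by
  have h1 := 𝒢.mul_assoc (𝒢.inv h) h k (𝒢.src_inv h) e
  rw [𝒢.mul_congr _ (𝒢.inv_mul h) rfl, 𝒢.unit_mul'] at h1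
  exact h1.symm

theorem mul_rdiv (h k : G) (e : 𝒢.src h = 𝒢.rng k) :
    𝒢.rdiv (𝒢.mul h k e) k (𝒢.src_mul h k e) = h := by
  have h1 := 𝒢.mul_assoc h k (𝒢.inv k) e (𝒢.rng_inv k).symm
  rw [𝒢.mul_congr _ rfl (𝒢.mul_inv k), 𝒢.mul_unit'] at h1
  exact h1

theorem rdiv_ldiv (h g : G) (e : 𝒢.rng h = 𝒢.rng g) :
    𝒢.rdiv g (𝒢.ldiv h g e) (𝒢.src_ldiv h g e).symm = h := by
  have h1 := 𝒢.mul_rdiv h (𝒢.ldiv h g e) (𝒢.rng_ldiv h g e).symm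
  simp only [𝒢.mul_ldiv] at h1
  exact h1

theorem ldiv_rdiv (g k : G) (e : 𝒢.src g = 𝒢.src k) :
    𝒢.ldiv (𝒢.rdiv g k e) g (𝒢.rng_rdiv g k e) = k := by
  have h1 := 𝒢.ldiv_mul (𝒢.rdiv g k e) k (𝒢.src_rdiv g k e)
  simp only [𝒢.rdiv_mul] at h1
  exact h1

theorem inv_rdiv (g k : G) (e : 𝒢.src g = 𝒢.src k) :
    𝒢.inv (𝒢.rdiv g k e) = 𝒢.rdiv k g e.symm := by
  refine 𝒢.inv_eq_of_mul _ _ ((𝒢.src_rdiv g k e).trans (𝒢.rng_rdiv k g e.symm).symm) (𝒢.rng g) ?_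
  have h1 := 𝒢.mul_assoc (𝒢.rdiv g k e) k (𝒢.inv g) (𝒢.src_rdiv g k e)
    (e.symm.trans (𝒢.rng_inv g).symm)
  rw [𝒢.mul_congr _ (𝒢.rdiv_mul g k e) rfl, 𝒢.mul_inv] at h1
  exact h1.symm

theorem rdiv_rdiv (h g k : G) (e : 𝒢.rng h = 𝒢.rng g) (e' : 𝒢.src g = 𝒢.src k) :
    𝒢.rdiv (𝒢.ldiv h g e) k ((𝒢.src_ldiv h g e).trans e') =
      𝒢.ldiv h (𝒢.rdiv g k e') (e.trans (𝒢.rng_rdiv g k e').symm) :=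
  𝒢.mul_assoc _ _ _ _ _

/-- For fixed `g`, the arrows `h` with the range of `g` correspond to the arrows `h⁻¹ g` with
the source of `g`. -/
def fiberEquiv (g : G) (x : X) (hg : 𝒢.src g = x) : 𝒢.RngFiber (𝒢.rng g) ≃ 𝒢.SrcFiber x where
  toFun h := ⟨𝒢.ldiv h g h.2, (𝒢.src_ldiv _ _ _).trans hg⟩
  invFun k := ⟨𝒢.rdiv g k (hg.trans k.2.symm), 𝒢.rng_rdiv _ _ _⟩
  left_inv h := Subtype.ext (𝒢.rdiv_ldiv h g h.2)
  right_inv k := Subtype.ext (𝒢.ldiv_rdiv g k (hg.trans k.2.symm))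

/-- Inversion as a homeomorphism. -/
def invHomeo : G ≃ₜ G where
  toFun := 𝒢.inv
  invFun := 𝒢.inv
  left_inv := 𝒢.inv_inv
  right_inv := 𝒢.inv_inv
  continuous_toFun := 𝒢.continuous_inv
  continuous_invFun := 𝒢.continuous_inv

/-- The involution `f*(g) = conj (f (g⁻¹))` on `C_c(G)`. -/
noncomputable def involution (f : C_c(G, ℂ)) : C_c(G, ℂ) where
  toFun g := conj (f (𝒢.inv g))
  continuous_toFun := Complex.continuous_conj.comp (f.continuous.comp 𝒢.continuous_inv)
  hasCompactSupport' := by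
    have h1 : HasCompactSupport (f ∘ 𝒢.invHomeo) := f.hasCompactSupport.comp_homeomorph _
    exact h1.comp_left (g := fun z : ℂ => conj z) (map_zero _)

theorem involution_apply (f : C_c(G, ℂ)) (g : G) :
    𝒢.involution f g = conj (f (𝒢.inv g)) := rfl

/-- A compactly supported function is uniformly summable over the range fibres. -/
theorem exists_fiber_bound (f : C_c(G, ℂ)) :
    ∃ C : ℝ, 0 ≤ C ∧ ∀ x, ∀ s : Finset (𝒢.RngFiber x), ∑ h ∈ s, ‖f h‖ ≤ C := by
  classical
  obtain ⟨B, hB⟩ : ∃ B, ∀ g, ‖f g‖ ≤ B :=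
    f.hasCompactSupport.exists_bound_of_continuous f.continuous
  have hK : IsCompact (tsupport f) := f.hasCompactSupport
  choose e he using 𝒢.isLocalHomeomorph_rng
  obtain ⟨t, ht⟩ := hK.elim_finite_subcover (fun g => (e g).source) (fun g => (e g).open_source)
    (fun g _ => Set.mem_iUnion.2 ⟨g, (he g).1⟩)
  have hB0 : 0 ≤ max B 0 := le_max_right _ _
  refine ⟨t.card * max B 0, by positivity, fun x s => ?_⟩
  have hsupp : ∀ h : G, f h ≠ 0 → ∃ g ∈ t, h ∈ (e g).source := by
    intro h hh
    have := ht (subset_tsupport f hh)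
    simpa using this
  calc ∑ h ∈ s, ‖f h‖ ≤ ∑ h ∈ s, ∑ g ∈ t, if (h : G) ∈ (e g).source then max B 0 else 0 := by
        refine Finset.sum_le_sum fun h _ => ?_
        by_cases hh : f h = 0
        · rw [hh, norm_zero]
          exact Finset.sum_nonneg fun g _ => by split_ifs <;> simp
        · obtain ⟨g, hg, hg'⟩ := hsupp h hh
          refine le_trans ?_ (Finset.single_le_sum (f := fun g => if (h : G) ∈ (e g).source then
            max B 0 else 0) (fun g _ => by split_ifs <;> simp) hg)
          simp only [hg', if_true]
          exact (hB _).trans (le_max_left _ _)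
    _ = ∑ g ∈ t, ∑ h ∈ s, if (h : G) ∈ (e g).source then max B 0 else 0 := Finset.sum_comm
    _ ≤ ∑ g ∈ t, max B 0 := by
        refine Finset.sum_le_sum fun g _ => ?_
        rw [← Finset.sum_filter, Finset.sum_const, nsmul_eq_mul]
        have : (s.filter fun h : 𝒢.RngFiber x => (h : G) ∈ (e g).source).card ≤ 1 := by
          refine Finset.card_le_one.2 fun a ha b hb => ?_
          simp only [Finset.mem_filter] at ha hb
          refine Subtype.ext ((e g).injOn ha.2 hb.2 ?_)
          rw [← (he g).2]
          exact a.2.trans b.2.symm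
        calc _ ≤ ((1 : ℕ) : ℝ) * max B 0 := by gcongr
          _ = _ := by simp
    _ = t.card * max B 0 := by simp

end EtaleGroupoid

/-- Schur test for a matrix with bounded row and column sums. -/
theorem schur_sum_bound {ι : Type*} (K : ι → ι → ℂ) (C : ℝ)
    (hrow : ∀ g, ∀ s : Finset ι, ∑ k ∈ s, ‖K g k‖ ≤ C)
    (hcol : ∀ k, ∀ s : Finset ι, ∑ g ∈ s, ‖K g k‖ ≤ C)
    (ψ : lp (fun _ : ι => ℂ) 2) :
    (∀ g, Summable fun k => K g k * ψ k) ∧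
    ∀ s : Finset ι, ∑ g ∈ s, ‖∑' k, K g k * ψ k‖ ^ 2 ≤ (C * ‖ψ‖) ^ 2 := by
  have hb : ∀ k, ‖ψ k‖ ≤ ‖ψ‖ := lp.norm_apply_le_norm two_ne_zero ψ
  have hKs : ∀ g, Summable fun k => ‖K g k‖ := fun g =>
    summable_of_sum_le (fun _ => norm_nonneg _) (hrow g)
  have hs1 : ∀ g, Summable fun k => ‖K g k * ψ k‖ := fun g => by
    refine Summable.of_nonneg_of_le (fun _ => norm_nonneg _) (fun k => ?_)
      ((hKs g).mul_right ‖ψ‖)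
    rw [norm_mul]
    gcongr
    exact hb k
  have hs2 : ∀ g, Summable fun k => ‖K g k‖ * ‖ψ k‖ ^ 2 := fun g => by
    refine Summable.of_nonneg_of_le (fun _ => by positivity) (fun k => ?_)
      ((hKs g).mul_right (‖ψ‖ ^ 2))
    gcongr
    exact hb k
  have hψ : HasSum (fun k => ‖ψ k‖ ^ 2) (‖ψ‖ ^ 2) := by
    have h1 := lp.hasSum_norm (p := 2) (by simp) ψ
    simpa using h1
  refine ⟨fun g => (hs1 g).of_norm, fun s => ?_⟩
  rcases isEmpty_or_nonempty ι with hι | ⟨⟨i0⟩⟩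
  · have : s = ∅ := Finset.eq_empty_of_isEmpty s
    simp only [this, Finset.sum_empty]
    positivity
  have hC : 0 ≤ C := by simpa using hrow i0 ∅
  have key : ∀ g, ‖∑' k, K g k * ψ k‖ ^ 2 ≤ C * ∑' k, ‖K g k‖ * ‖ψ k‖ ^ 2 := by
    intro g
    have h1 : ‖∑' k, K g k * ψ k‖ ≤ ∑' k, ‖K g k * ψ k‖ := norm_tsum_le_tsum_norm (hs1 g)
    have h2 : (∑' k, ‖K g k * ψ k‖) ≤ Real.sqrt (C * ∑' k, ‖K g k‖ * ‖ψ k‖ ^ 2) := by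
      refine (hs1 g).tsum_le_of_sum_le fun F => Real.le_sqrt_of_sq_le ?_
      refine (Finset.sum_sq_le_sum_mul_sum_of_sq_le_mul F (f := fun k => ‖K g k‖)
        (g := fun k => ‖K g k‖ * ‖ψ k‖ ^ 2) (fun _ _ => norm_nonneg _)
        (fun _ _ => by positivity) (fun k _ => le_of_eq (by rw [norm_mul]; ring))).trans ?_
      refine mul_le_mul (hrow g F) ((hs2 g).sum_le_tsum F (fun _ _ => by positivity))
        (Finset.sum_nonneg fun _ _ => by positivity) hC
    have h3 : 0 ≤ C * ∑' k, ‖K g k‖ * ‖ψ k‖ ^ 2 :=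
      mul_nonneg hC (tsum_nonneg fun _ => by positivity)
    calc _ ≤ Real.sqrt (C * ∑' k, ‖K g k‖ * ‖ψ k‖ ^ 2) ^ 2 := by gcongr; exact h1.trans h2
      _ = _ := Real.sq_sqrt h3
  calc ∑ g ∈ s, ‖∑' k, K g k * ψ k‖ ^ 2 ≤ ∑ g ∈ s, C * ∑' k, ‖K g k‖ * ‖ψ k‖ ^ 2 :=
        Finset.sum_le_sum fun g _ => key g
    _ = C * ∑' k, ∑ g ∈ s, ‖K g k‖ * ‖ψ k‖ ^ 2 := by
        rw [← Finset.mul_sum, Summable.tsum_finsetSum fun g _ => hs2 g]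
    _ ≤ C * ∑' k, C * ‖ψ k‖ ^ 2 := by
        refine mul_le_mul_of_nonneg_left ?_ hC
        refine Summable.tsum_le_tsum (fun k => ?_) (summable_sum fun g _ => hs2 g)
          (hψ.summable.mul_left C)
        rw [← Finset.sum_mul]
        gcongr
        exact hcol k s
    _ = (C * ‖ψ‖) ^ 2 := by
        rw [tsum_mul_left, hψ.tsum_eq]; ring

namespace EtaleGroupoid

variable {G : Type u} {X : Type v} [TopologicalSpace G] [TopologicalSpace X]
  (𝒢 : EtaleGroupoid G X)

theorem exists_schur_bound (f : C_c(G, ℂ)) :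
    ∃ C : ℝ, 0 ≤ C ∧ ∀ x : X,
      (∀ (g : 𝒢.SrcFiber x) (s : Finset (𝒢.SrcFiber x)),
        ∑ k ∈ s, ‖f (𝒢.rdiv g k (g.2.trans k.2.symm))‖ ≤ C) ∧
      (∀ (k : 𝒢.SrcFiber x) (s : Finset (𝒢.SrcFiber x)),
        ∑ g ∈ s, ‖f (𝒢.rdiv g k (g.2.trans k.2.symm))‖ ≤ C) := by
  have main : ∀ f : C_c(G, ℂ), ∃ C : ℝ, 0 ≤ C ∧ ∀ x : X,
      ∀ (g : 𝒢.SrcFiber x) (s : Finset (𝒢.SrcFiber x)),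
        ∑ k ∈ s, ‖f (𝒢.rdiv g k (g.2.trans k.2.symm))‖ ≤ C := by
    intro f
    obtain ⟨C, hC, h⟩ := 𝒢.exists_fiber_bound f
    refine ⟨C, hC, fun x g s => ?_⟩
    have h1 := h (𝒢.rng g) (s.map (𝒢.fiberEquiv g x g.2).symm.toEmbedding)
    rw [Finset.sum_map] at h1
    exact h1
  obtain ⟨C, hC, h⟩ := main f
  obtain ⟨C', hC', h'⟩ := main (𝒢.involution f)
  refine ⟨max C C', hC.trans (le_max_left _ _), fun x => ⟨fun g s => (h x g s).trans
    (le_max_left _ _), fun k s => le_trans (le_of_eq ?_) ((h' x k s).trans (le_max_right _ _))⟩⟩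
  refine Finset.sum_congr rfl fun g _ => ?_
  rw [involution_apply, inv_rdiv, RCLike.norm_conj]

theorem tsum_fiber_eq (f : G → ℂ) {x : X} (ψ : 𝒢.SrcFiber x → ℂ) (g : 𝒢.SrcFiber x) :
    ∑' h : 𝒢.RngFiber (𝒢.rng g), f h * ψ ⟨𝒢.ldiv h g h.2, (𝒢.src_ldiv h g h.2).trans g.2⟩ =
      ∑' k : 𝒢.SrcFiber x, f (𝒢.rdiv g k (g.2.trans k.2.symm)) * ψ k := by
  rw [← (𝒢.fiberEquiv g x g.2).tsum_eq]
  refine tsum_congr fun h => ?_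
  congr 2
  exact (𝒢.rdiv_ldiv h g h.2).symm

/-- The representation of `C_c(G)` on the square-summable functions on the source fibre of `x`,
given by `(f ψ)(g) = ∑ f(h) ψ(h⁻¹ g)`, where `h` runs over the arrows with the range of `g`. -/
noncomputable def regRep (x : X) (f : C_c(G, ℂ)) : 𝒢.Hilb x →L[ℂ] 𝒢.Hilb x :=
  LinearMap.mkContinuousOfExistsBound
    { toFun := fun ψ => ⟨fun g => ∑' h : 𝒢.RngFiber (𝒢.rng g),
          f h * ψ ⟨𝒢.ldiv h g h.2, (𝒢.src_ldiv h g h.2).trans g.2⟩, by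
        obtain ⟨C, -, h⟩ := 𝒢.exists_schur_bound f
        refine memℓp_gen' (C := (C * ‖ψ‖) ^ 2) fun s => ?_
        have h1 := (schur_sum_bound _ C (h x).1 (h x).2 ψ).2 s
        simpa [tsum_fiber_eq] using h1⟩
      map_add' := fun ψ φ => by
        obtain ⟨C, -, h⟩ := 𝒢.exists_schur_bound f
        ext g
        simp only [lp.coeFn_add, Pi.add_apply, tsum_fiber_eq]
        have h1 := (schur_sum_bound _ C (h x).1 (h x).2 ψ).1 g
        have h2 := (schur_sum_bound _ C (h x).1 (h x).2 φ).1 g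
        rw [← h1.tsum_add h2]
        exact (𝒢.tsum_fiber_eq f (fun k => ψ k + φ k) g).trans
          (tsum_congr fun k => mul_add _ _ _)
      map_smul' := fun c ψ => by
        ext g
        simp only [lp.coeFn_smul, Pi.smul_apply, smul_eq_mul, RingHom.id_apply]
        rw [← tsum_mul_left]
        exact tsum_congr fun h => mul_left_comm _ _ _ }
    (by
      obtain ⟨C, hC, h⟩ := 𝒢.exists_schur_bound f
      refine ⟨C, fun ψ => ?_⟩
      refine lp.norm_le_of_forall_sum_le (p := 2) (by simp) (by positivity) fun s => ?_
      have h1 := (schur_sum_bound _ C (h x).1 (h x).2 ψ).2 s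
      simpa [tsum_fiber_eq] using h1)

theorem regRep_apply (x : X) (f : C_c(G, ℂ)) (ψ : 𝒢.Hilb x) (g : 𝒢.SrcFiber x) :
    𝒢.regRep x f ψ g = ∑' h : 𝒢.RngFiber (𝒢.rng g),
      f h * ψ ⟨𝒢.ldiv h g h.2, (𝒢.src_ldiv h g h.2).trans g.2⟩ := rfl

theorem exists_norm_regRep_le (f : C_c(G, ℂ)) : ∃ C : ℝ, ∀ x, ‖𝒢.regRep x f‖ ≤ C := by
  obtain ⟨C, hC, h⟩ := 𝒢.exists_schur_bound f
  refine ⟨C, fun x => ContinuousLinearMap.opNorm_le_bound _ hC fun ψ => ?_⟩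
  refine lp.norm_le_of_forall_sum_le (p := 2) (by simp) (by positivity) fun s => ?_
  have h1 := (schur_sum_bound _ C (h x).1 (h x).2 ψ).2 s
  simpa [regRep_apply, tsum_fiber_eq] using h1

open Classical in
theorem regRep_single (x : X) (f : C_c(G, ℂ)) (g k : 𝒢.SrcFiber x) :
    𝒢.regRep x f (lp.single 2 k 1) g = f (𝒢.rdiv g k (g.2.trans k.2.symm)) := by
  rw [regRep_apply, tsum_fiber_eq, tsum_eq_single k]
  · simp
  · intro k' hk'
    rw [lp.single_apply_ne _ _ _ hk', mul_zero]

open Classical in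
theorem hilb_ext {x : X} {S T : 𝒢.Hilb x →L[ℂ] 𝒢.Hilb x}
    (H : ∀ k g : 𝒢.SrcFiber x, S (lp.single 2 k 1) g = T (lp.single 2 k 1) g) : S = T := by
  refine ContinuousLinearMap.ext fun ψ => ?_
  have h0 := lp.hasSum_single (p := 2) (by simp) ψ
  have h1 : HasSum (fun k => S (lp.single 2 k (ψ k))) (S ψ) := h0.mapL S
  have h2 : HasSum (fun k => T (lp.single 2 k (ψ k))) (T ψ) := h0.mapL T
  have h3 : ∀ k, lp.single 2 k (ψ k) = ψ k • (lp.single 2 k 1 : 𝒢.Hilb x) := by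
    intro k; rw [← lp.single_smul]; simp
  have h4 : (fun k => S (lp.single 2 k (ψ k))) = fun k => T (lp.single 2 k (ψ k)) := by
    funext k
    rw [h3, map_smul, map_smul]
    congr 1
    ext g
    exact H k g
  rw [h4] at h1
  exact h1.unique h2

theorem regRep_add (x : X) (f₁ f₂ : C_c(G, ℂ)) :
    𝒢.regRep x (f₁ + f₂) = 𝒢.regRep x f₁ + 𝒢.regRep x f₂ := by
  refine 𝒢.hilb_ext fun k g => ?_
  simp [regRep_single]

theorem regRep_smul (x : X) (c : ℂ) (f : C_c(G, ℂ)) :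
    𝒢.regRep x (c • f) = c • 𝒢.regRep x f := by
  refine 𝒢.hilb_ext fun k g => ?_
  simp [regRep_single]

theorem regRep_involution (x : X) (f : C_c(G, ℂ)) :
    𝒢.regRep x (𝒢.involution f) = star (𝒢.regRep x f) := by
  classical
  refine 𝒢.hilb_ext fun k g => ?_
  rw [regRep_single, involution_apply, inv_rdiv]
  have h1 : ∀ (φ : 𝒢.Hilb x), φ g = inner ℂ (lp.single 2 g 1 : 𝒢.Hilb x) φ := by
    intro φ; rw [lp.inner_single_left]; simp
  rw [h1, ContinuousLinearMap.star_eq_adjoint, ContinuousLinearMap.adjoint_inner_right,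
    lp.inner_single_right, regRep_single]
  simp

section conv

/-- The convolution `(f₁ * f₂)(g) = ∑ f₁(h) f₂(h⁻¹ g)` of two functions, where `h` runs over the
arrows with the range of `g`. -/
noncomputable def convFun (f₁ f₂ : G → ℂ) (g : G) : ℂ :=
  ∑' h : 𝒢.RngFiber (𝒢.rng g), f₁ h * f₂ (𝒢.ldiv h g h.2)

theorem t2Space_units [T2Space G] (𝒢 : EtaleGroupoid G X) : T2Space X :=
  T2Space.of_injective_continuous (f := 𝒢.unit)
    (Function.LeftInverse.injective 𝒢.src_unit) 𝒢.continuous_unit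

theorem continuous_convFun_of_bisection [T2Space G] (f₁ f₂ : G → ℂ) (h₁ : Continuous f₁)
    (h₂ : Continuous f₂) (hc : HasCompactSupport f₁) (e : OpenPartialHomeomorph G X)
    (he : 𝒢.rng = e) (hs : tsupport f₁ ⊆ e.source) : Continuous (𝒢.convFun f₁ f₂) := by
  have := 𝒢.t2Space_units
  rw [continuous_iff_continuousAt]
  intro g
  by_cases hg : 𝒢.rng g ∈ 𝒢.rng '' tsupport f₁
  · have hg' : 𝒢.rng g ∈ e.target := by
      obtain ⟨h, hh, e1⟩ := hg
      rw [← e1, he]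
      exact e.map_source (hs hh)
    have hopen : IsOpen (𝒢.rng ⁻¹' e.target) := e.open_target.preimage 𝒢.continuous_rng
    refine ContinuousOn.continuousAt (s := 𝒢.rng ⁻¹' e.target) ?_ (hopen.mem_nhds hg')
    have hr : ∀ g : (𝒢.rng ⁻¹' e.target : Set G), 𝒢.rng (e.symm (𝒢.rng g)) = 𝒢.rng g := by
      intro g
      have h1 : e (e.symm (𝒢.rng g)) = 𝒢.rng g := e.right_inv g.2
      rwa [← he] at h1
    have hcs : Continuous fun g : (𝒢.rng ⁻¹' e.target : Set G) => e.symm (𝒢.rng g) :=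
      e.continuousOn_symm.comp_continuous (𝒢.continuous_rng.comp continuous_subtype_val)
        (fun g => g.2)
    have hcl : Continuous fun g : (𝒢.rng ⁻¹' e.target : Set G) =>
        𝒢.ldiv (e.symm (𝒢.rng g)) g (hr g) :=
      𝒢.continuous_mul.comp (Continuous.subtype_mk
        ((𝒢.continuous_inv.comp hcs).prodMk continuous_subtype_val)
        (fun g => (𝒢.src_inv _).trans (hr g)))
    rw [continuousOn_iff_continuous_domRestrict]
    refine Continuous.congr ((h₁.comp hcs).mul (h₂.comp hcl)) fun g => ?_
    rw [Set.domRestrict_apply, convFun, tsum_eq_single ⟨e.symm (𝒢.rng g), hr g⟩]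
    · rfl
    · intro h hne
      have : f₁ h = 0 := by
        by_contra h0
        refine hne (Subtype.ext (e.injOn (hs (subset_tsupport _ h0)) (e.map_target g.2) ?_))
        rw [← he]
        exact h.2.trans (hr g).symm
      rw [this, zero_mul]
  · have hcl : IsClosed (𝒢.rng '' tsupport f₁) := (hc.isCompact.image 𝒢.continuous_rng).isClosed
    have hopen : IsOpen (𝒢.rng ⁻¹' (𝒢.rng '' tsupport f₁)ᶜ) :=
      hcl.isOpen_compl.preimage 𝒢.continuous_rng
    refine (continuousAt_const (y := (0 : ℂ))).congr ?_
    filter_upwards [hopen.mem_nhds hg] with g' hg'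
    rw [convFun]
    refine ((tsum_congr fun h => ?_).trans tsum_zero).symm
    have : f₁ h = 0 := by
      by_contra h0
      exact hg' ⟨h, subset_tsupport _ h0, h.2⟩
    rw [this, zero_mul]

theorem summable_conv (f₁ f₂ : C_c(G, ℂ)) (g : G) :
    Summable fun h : 𝒢.RngFiber (𝒢.rng g) => f₁ h * f₂ (𝒢.ldiv h g h.2) := by
  obtain ⟨C, hC, h⟩ := 𝒢.exists_fiber_bound f₁
  obtain ⟨B, hB⟩ : ∃ B, ∀ g, ‖f₂ g‖ ≤ B :=
    f₂.hasCompactSupport.exists_bound_of_continuous f₂.continuous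
  have hs : Summable fun h : 𝒢.RngFiber (𝒢.rng g) => ‖f₁ h‖ :=
    summable_of_sum_le (fun _ => norm_nonneg _) (h _)
  refine Summable.of_norm (Summable.of_nonneg_of_le (fun _ => norm_nonneg _) (fun k => ?_)
    (hs.mul_right B))
  rw [norm_mul]
  gcongr
  exact hB _

theorem continuous_convFun [T2Space G] [LocallyCompactSpace G] (f₁ f₂ : C_c(G, ℂ)) :
    Continuous (𝒢.convFun f₁ f₂) := by
  have hK : IsCompact (tsupport f₁) := f₁.hasCompactSupport
  choose e he using 𝒢.isLocalHomeomorph_rng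
  obtain ⟨t, ht⟩ := hK.elim_finite_subcover (fun g => (e g).source) (fun g => (e g).open_source)
    (fun g _ => Set.mem_iUnion.2 ⟨g, (he g).1⟩)
  have ht' : tsupport f₁ ⊆ ⋃ i : Fin t.card, (e (t.equivFin.symm i : t)).source := by
    intro g hg
    obtain ⟨k, hk, hg'⟩ := Set.mem_iUnion₂.1 (ht hg)
    exact Set.mem_iUnion.2 ⟨t.equivFin ⟨k, hk⟩, by simpa using hg'⟩
  obtain ⟨φ, hφ, hsum, -, -⟩ := exists_continuous_sum_one_of_isOpen_isCompact
    (fun i => (e (t.equivFin.symm i : t)).open_source) hK ht'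
  let F : Fin t.card → C_c(G, ℂ) := fun i =>
    { toFun := fun g => (φ i g : ℂ) * f₁ g
      continuous_toFun := (Complex.continuous_ofReal.comp (φ i).continuous).mul f₁.continuous
      hasCompactSupport' := f₁.hasCompactSupport.mul_left }
  have hF : ∀ g, f₁ g = ∑ i, F i g := by
    intro g
    by_cases hg : f₁ g = 0
    · rw [hg]
      exact (Finset.sum_eq_zero fun i _ => by
        change (φ i g : ℂ) * f₁ g = 0
        rw [hg, mul_zero]).symm
    · have h1 := hsum (subset_tsupport _ hg)
      rw [Finset.sum_apply] at h1
      change f₁ g = ∑ i, (φ i g : ℂ) * f₁ g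
      rw [← Finset.sum_mul, ← Complex.ofReal_sum, h1]
      simp
  have hconv : 𝒢.convFun f₁ f₂ = fun g => ∑ i, 𝒢.convFun (F i) f₂ g := by
    funext g
    simp only [convFun]
    rw [← Summable.tsum_finsetSum fun i _ => 𝒢.summable_conv (F i) f₂ g]
    exact tsum_congr fun h => by rw [hF, Finset.sum_mul]
  rw [hconv]
  refine continuous_finsetSum _ fun i _ => ?_
  refine 𝒢.continuous_convFun_of_bisection _ _ (F i).continuous f₂.continuous
    (F i).hasCompactSupport (e (t.equivFin.symm i : t))
    (he (t.equivFin.symm i : t)).2 ?_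
  refine (closure_mono fun g hg => ?_).trans (hφ i)
  intro h0
  apply hg
  change (φ i g : ℂ) * f₁ g = 0
  rw [h0]; simp

theorem hasCompactSupport_convFun [T2Space G] (f₁ f₂ : C_c(G, ℂ)) :
    HasCompactSupport (𝒢.convFun f₁ f₂) := by
  have := 𝒢.t2Space_units
  have hK : IsCompact (tsupport f₁ ×ˢ tsupport f₂) :=
    (f₁.hasCompactSupport.isCompact).prod f₂.hasCompactSupport.isCompact
  have hD : IsClosed {p : G × G | 𝒢.src p.1 = 𝒢.rng p.2} :=
    isClosed_eq (𝒢.continuous_src.comp continuous_fst) (𝒢.continuous_rng.comp continuous_snd)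
  have hK' : IsCompact ((Subtype.val : {p : G × G // 𝒢.src p.1 = 𝒢.rng p.2} → G × G) ⁻¹'
      (tsupport f₁ ×ˢ tsupport f₂)) := hD.isClosedEmbedding_subtypeVal.isCompact_preimage hK
  refine HasCompactSupport.intro (hK'.image 𝒢.continuous_mul) fun g hg => ?_
  rw [convFun]
  refine (tsum_congr fun h => ?_).trans tsum_zero
  by_contra h0
  refine hg ⟨⟨(h, 𝒢.ldiv h g h.2), (𝒢.rng_ldiv h g h.2).symm⟩, ⟨?_, ?_⟩, 𝒢.mul_ldiv h g h.2⟩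
  · exact subset_tsupport _ (left_ne_zero_of_mul h0)
  · exact subset_tsupport _ (right_ne_zero_of_mul h0)

/-- The convolution product on `C_c(G)`. -/
noncomputable def conv [T2Space G] [LocallyCompactSpace G] (f₁ f₂ : C_c(G, ℂ)) : C_c(G, ℂ) where
  toFun := 𝒢.convFun f₁ f₂
  continuous_toFun := 𝒢.continuous_convFun f₁ f₂
  hasCompactSupport' := 𝒢.hasCompactSupport_convFun f₁ f₂

theorem regRep_conv [T2Space G] [LocallyCompactSpace G] (x : X) (f₁ f₂ : C_c(G, ℂ)) :
    𝒢.regRep x (𝒢.conv f₁ f₂) = 𝒢.regRep x f₁ * 𝒢.regRep x f₂ := by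
  classical
  refine 𝒢.hilb_ext fun k g => ?_
  rw [regRep_single, mul_apply_eq_comp, regRep_apply]
  simp only [regRep_single]
  change 𝒢.convFun f₁ f₂ _ = _
  have e := 𝒢.rng_rdiv g k (g.2.trans k.2.symm)
  rw [convFun, ← (Equiv.subtypeEquivRight (fun h => by rw [e]) :
    𝒢.RngFiber (𝒢.rng g) ≃ 𝒢.RngFiber (𝒢.rng (𝒢.rdiv g k (g.2.trans k.2.symm)))).tsum_eq]
  refine tsum_congr fun h => ?_
  congr 2
  exact (𝒢.rdiv_rdiv h g k h.2 (g.2.trans k.2.symm)).symm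

end conv

end EtaleGroupoid

namespace EtaleGroupoid

variable {G : Type u} {X : Type v} [TopologicalSpace G] [TopologicalSpace X]
  (𝒢 : EtaleGroupoid G X)

/-- The `C*`-algebra of bounded families of operators on the Hilbert spaces of the source fibres,
with the supremum norm. -/
def BddFamilies : Type (max u v) := lp (fun x : X => 𝒢.Hilb x →L[ℂ] 𝒢.Hilb x) ∞

noncomputable instance : NonUnitalCStarAlgebra 𝒢.BddFamilies :=
  inferInstanceAs (NonUnitalCStarAlgebra (lp (fun x : X => 𝒢.Hilb x →L[ℂ] 𝒢.Hilb x) ∞))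

variable {𝒢} in
/-- The members of a bounded family of operators. -/
def BddFamilies.op (a : 𝒢.BddFamilies) (x : X) : 𝒢.Hilb x →L[ℂ] 𝒢.Hilb x := a.1 x

variable {𝒢} in
theorem BddFamilies.ext {a b : 𝒢.BddFamilies} (h : ∀ x, a.op x = b.op x) : a = b :=
  Subtype.ext (funext h)

/-- The map sending `f` in `C_c(G)` to the family of all `regRep x f`. -/
noncomputable def rep : C_c(G, ℂ) →ₗ[ℂ] 𝒢.BddFamilies where
  toFun f := ⟨fun x => 𝒢.regRep x f, memℓp_infty (by
    obtain ⟨C, hC⟩ := 𝒢.exists_norm_regRep_le f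
    exact ⟨C, by rintro _ ⟨x, rfl⟩; exact hC x⟩)⟩
  map_add' f g := BddFamilies.ext fun x => 𝒢.regRep_add x f g
  map_smul' c f := BddFamilies.ext fun x => 𝒢.regRep_smul x c f

variable [T2Space G] [LocallyCompactSpace G]

/-- The image of the convolution algebra `C_c(G)`. -/
noncomputable def ccImage : NonUnitalStarSubalgebra ℂ 𝒢.BddFamilies where
  carrier := Set.range 𝒢.rep
  add_mem' := by rintro _ _ ⟨f, rfl⟩ ⟨g, rfl⟩; exact ⟨f + g, (𝒢.rep).map_add _ _⟩
  zero_mem' := ⟨0, (𝒢.rep).map_zero⟩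
  mul_mem' := by
    rintro _ _ ⟨f, rfl⟩ ⟨g, rfl⟩
    exact ⟨𝒢.conv f g, BddFamilies.ext fun x => 𝒢.regRep_conv x f g⟩
  smul_mem' := by rintro c _ ⟨f, rfl⟩; exact ⟨c • f, (𝒢.rep).map_smul _ _⟩
  star_mem' := by
    rintro _ ⟨f, rfl⟩
    exact ⟨𝒢.involution f, BddFamilies.ext fun x => 𝒢.regRep_involution x f⟩

/-- The reduced groupoid `C*`-algebra: the completion of the convolution algebra `C_c(G)` in the
norm `‖f‖ = sup_x ‖regRep x f‖`, realised as the closure of `C_c(G)` in `BddFamilies`. -/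
def ReducedCStar : Type (max u v) := 𝒢.ccImage.topologicalClosure

noncomputable instance : NonUnitalCStarAlgebra 𝒢.ReducedCStar :=
  NonUnitalStarSubalgebra.nonUnitalCStarAlgebra (𝒢.ccImage.topologicalClosure)
    (h_closed := 𝒢.ccImage.isClosed_topologicalClosure)

noncomputable instance : PartialOrder 𝒢.ReducedCStar := CStarAlgebra.spectralOrder _

instance : StarOrderedRing 𝒢.ReducedCStar := CStarAlgebra.spectralOrderedRing _

/-- The canonical embedding of `C_c(G)` into the reduced groupoid `C*`-algebra. -/
noncomputable def ofCc : C_c(G, ℂ) →ₗ[ℂ] 𝒢.ReducedCStar where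
  toFun f := ⟨𝒢.rep f, 𝒢.ccImage.le_topologicalClosure ⟨f, rfl⟩⟩
  map_add' f g := Subtype.ext (𝒢.rep.map_add f g)
  map_smul' c f := Subtype.ext (𝒢.rep.map_smul c f)

theorem norm_ofCc (f : C_c(G, ℂ)) : ‖𝒢.ofCc f‖ = ⨆ x, ‖𝒢.regRep x f‖ :=
  lp.norm_eq_ciSup (E := fun x : X => 𝒢.Hilb x →L[ℂ] 𝒢.Hilb x) (𝒢.rep f)

theorem ofCc_conv (f g : C_c(G, ℂ)) : 𝒢.ofCc (𝒢.conv f g) = 𝒢.ofCc f * 𝒢.ofCc g :=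
  Subtype.ext (BddFamilies.ext fun x => 𝒢.regRep_conv x f g)

theorem ofCc_involution (f : C_c(G, ℂ)) : 𝒢.ofCc (𝒢.involution f) = star (𝒢.ofCc f) :=
  Subtype.ext (BddFamilies.ext fun x => 𝒢.regRep_involution x f)

theorem exists_norm_sub_ofCc_lt (a : 𝒢.ReducedCStar) {ε : ℝ} (hε : 0 < ε) :
    ∃ f, ‖a - 𝒢.ofCc f‖ < ε := by
  obtain ⟨_, ⟨f, rfl⟩, h⟩ := Metric.mem_closure_iff.1 a.2 ε hε
  exact ⟨f, by rw [dist_eq_norm] at h; exact h⟩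

open Classical in
/-- The matrix coefficient of `a` at the unit `x`. -/
noncomputable def expectFun (a : 𝒢.ReducedCStar) (x : X) : ℂ :=
  a.1.op x (lp.single 2 (⟨𝒢.unit x, 𝒢.src_unit x⟩ : 𝒢.SrcFiber x) 1) ⟨𝒢.unit x, 𝒢.src_unit x⟩

theorem expectFun_add (a b : 𝒢.ReducedCStar) (x : X) :
    𝒢.expectFun (a + b) x = 𝒢.expectFun a x + 𝒢.expectFun b x := rfl

theorem expectFun_sub (a b : 𝒢.ReducedCStar) (x : X) :
    𝒢.expectFun (a - b) x = 𝒢.expectFun a x - 𝒢.expectFun b x := rfl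

theorem expectFun_smul (c : ℂ) (a : 𝒢.ReducedCStar) (x : X) :
    𝒢.expectFun (c • a) x = c * 𝒢.expectFun a x := rfl

theorem expectFun_ofCc (f : C_c(G, ℂ)) (x : X) : 𝒢.expectFun (𝒢.ofCc f) x = f (𝒢.unit x) := by
  refine (𝒢.regRep_single x f ⟨𝒢.unit x, 𝒢.src_unit x⟩ ⟨𝒢.unit x, 𝒢.src_unit x⟩).trans ?_
  congr 1
  change 𝒢.mul (𝒢.unit x) (𝒢.inv (𝒢.unit x)) _ = _
  rw [𝒢.mul_inv, 𝒢.rng_unit]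

theorem norm_expectFun_le (a : 𝒢.ReducedCStar) (x : X) : ‖𝒢.expectFun a x‖ ≤ ‖a‖ := by
  classical
  have h1 : ‖a.1.op x‖ ≤ ‖a‖ :=
    lp.norm_apply_le_norm (E := fun x : X => 𝒢.Hilb x →L[ℂ] 𝒢.Hilb x) ENNReal.top_ne_zero a.1 x
  refine (lp.norm_apply_le_norm two_ne_zero _ _).trans ((ContinuousLinearMap.le_opNorm _ _).trans ?_)
  rw [lp.norm_single (by simp), norm_one, mul_one]
  exact h1

theorem continuous_expectFun (a : 𝒢.ReducedCStar) : Continuous (𝒢.expectFun a) := by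
  refine continuous_of_uniform_approx_of_continuous fun u hu => ?_
  obtain ⟨ε, hε, hu⟩ := Metric.mem_uniformity_dist.1 hu
  obtain ⟨f, hf⟩ := 𝒢.exists_norm_sub_ofCc_lt a hε
  refine ⟨fun x => f (𝒢.unit x), f.continuous.comp 𝒢.continuous_unit, fun x => hu ?_⟩
  change dist _ (f (𝒢.unit x)) < ε
  rw [← expectFun_ofCc, dist_eq_norm, ← expectFun_sub]
  exact (𝒢.norm_expectFun_le _ x).trans_lt hf

theorem tendsto_expectFun (a : 𝒢.ReducedCStar) :
    Filter.Tendsto (𝒢.expectFun a) (Filter.cocompact X) (nhds 0) := by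
  have := 𝒢.t2Space_units
  rw [Metric.tendsto_nhds]
  intro ε hε
  obtain ⟨f, hf⟩ := 𝒢.exists_norm_sub_ofCc_lt a hε
  have hK : IsCompact (𝒢.rng '' tsupport f) :=
    f.hasCompactSupport.isCompact.image 𝒢.continuous_rng
  filter_upwards [hK.compl_mem_cocompact] with x hx
  have h0 : f (𝒢.unit x) = 0 := by
    by_contra h0
    exact hx ⟨𝒢.unit x, subset_tsupport _ h0, 𝒢.rng_unit x⟩
  have h1 := (𝒢.norm_expectFun_le (a - 𝒢.ofCc f) x).trans_lt hf
  rw [expectFun_sub, expectFun_ofCc, h0, sub_zero] at h1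
  rwa [dist_zero_right]

/-- The canonical conditional expectation of the reduced groupoid `C*`-algebra onto `C_0` of the
unit space: the continuous linear map that extends the restriction of functions in `C_c(G)` to the
unit space (see `expect_ofCc`). -/
noncomputable def expect : 𝒢.ReducedCStar →L[ℂ] C₀(X, ℂ) :=
  LinearMap.mkContinuous
    { toFun := fun a => ⟨⟨𝒢.expectFun a, 𝒢.continuous_expectFun a⟩, 𝒢.tendsto_expectFun a⟩
      map_add' := fun a b => by ext x; exact 𝒢.expectFun_add a b x
      map_smul' := fun c a => by ext x; exact 𝒢.expectFun_smul c a x } 1 (fun a => by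
    rw [one_mul, ← ZeroAtInftyContinuousMap.norm_toBCF_eq_norm]
    exact (BoundedContinuousFunction.norm_le (norm_nonneg a)).2 (𝒢.norm_expectFun_le a))

theorem expect_star_mul_self (a : 𝒢.ReducedCStar) (x : X) :
    ∃ v : ℝ, 0 ≤ v ∧ 𝒢.expect (star a * a) x = v := by
  classical
  set δ : 𝒢.Hilb x := lp.single 2 (⟨𝒢.unit x, 𝒢.src_unit x⟩ : 𝒢.SrcFiber x) 1 with hδ
  refine ⟨‖a.1.op x δ‖ ^ 2, by positivity, ?_⟩
  have h1 : ∀ (φ : 𝒢.Hilb x), φ ⟨𝒢.unit x, 𝒢.src_unit x⟩ = inner ℂ δ φ := by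
    intro φ; rw [hδ, lp.inner_single_left]; simp
  have h2 : 𝒢.expect (star a * a) x =
      (star (a.1.op x) * a.1.op x) δ ⟨𝒢.unit x, 𝒢.src_unit x⟩ := by
    rw [hδ]; rfl
  rw [h2, h1, mul_apply_eq_comp, ContinuousLinearMap.star_eq_adjoint,
    ContinuousLinearMap.adjoint_inner_right, inner_self_eq_norm_sq_to_K]
  simp

/-- The conditional expectation of a positive element is a non-negative function. -/
theorem expect_nonneg {a : 𝒢.ReducedCStar} (ha : 0 ≤ a) (x : X) :
    ∃ v : ℝ, 0 ≤ v ∧ 𝒢.expect a x = v := by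
  obtain ⟨b, rfl⟩ := CStarAlgebra.nonneg_iff_eq_star_mul_self.1 ha
  exact 𝒢.expect_star_mul_self b x

theorem expect_ofCc (f : C_c(G, ℂ)) (x : X) : 𝒢.expect (𝒢.ofCc f) x = f (𝒢.unit x) :=
  𝒢.expectFun_ofCc f x

end EtaleGroupoid

/-- A weight on a `C*`-algebra. -/
structure CStarWeight (A : Type*) [NonUnitalCStarAlgebra A] [PartialOrder A]
    [StarOrderedRing A] where
  toFun : {a : A // 0 ≤ a} → ℝ≥0∞
  map_add' : ∀ a b : {a : A // 0 ≤ a}, toFun ⟨a + b, add_nonneg a.2 b.2⟩ = toFun a + toFun b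
  map_smul' : ∀ (c : ℝ) (hc : 0 < c) (a : {a : A // 0 ≤ a}),
    toFun ⟨c • (a : A), smul_nonneg hc.le a.2⟩ = ENNReal.ofReal c * toFun a

namespace CStarWeight

variable {A : Type*} [NonUnitalCStarAlgebra A] [PartialOrder A] [StarOrderedRing A]
  (ψ : CStarWeight A)

/-- A weight is proper when it is non-zero, densely defined and lower semi-continuous. -/
structure IsProper : Prop where
  ne_zero : ∃ a, ψ.toFun a ≠ 0
  dense : Dense {a : {a : A // 0 ≤ a} | ψ.toFun a < ∞}
  lsc : LowerSemicontinuous ψ.toFun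

/-- The set of all `a` such that `ψ (a* a)` is finite. -/
def sqFinite : Set A := {a | ψ.toFun ⟨star a * a, star_mul_self_nonneg a⟩ < ∞}

/-- The span of all products `a* b` with `ψ (a* a)` and `ψ (b* b)` finite. -/
def domain : Submodule ℂ A :=
  Submodule.span ℂ {x | ∃ a ∈ ψ.sqFinite, ∃ b ∈ ψ.sqFinite, x = star a * b}

/-- A linear functional on `ψ.domain` that extends `ψ`. -/
def IsExtension (L : ψ.domain →ₗ[ℂ] ℂ) : Prop :=
  ∀ (a : ψ.domain) (ha : 0 ≤ (a : A)),
    ψ.toFun ⟨a, ha⟩ < ∞ ∧ L a = ((ψ.toFun ⟨a, ha⟩).toReal : ℂ)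

/-- A positive element of finite weight. -/
def FinPos (a : A) : Prop := ∃ ha : 0 ≤ a, ψ.toFun ⟨a, ha⟩ < ∞

open Classical in
/-- The value of the weight at `a` as a real number, used for positive `a` of finite weight. -/
noncomputable def val (a : A) : ℝ := if ha : 0 ≤ a then (ψ.toFun ⟨a, ha⟩).toReal else 0

variable {ψ}

theorem FinPos.add {a b : A} (ha : ψ.FinPos a) (hb : ψ.FinPos b) :
    ψ.FinPos (a + b) ∧ ψ.val (a + b) = ψ.val a + ψ.val b := by
  obtain ⟨ha, ha'⟩ := ha
  obtain ⟨hb, hb'⟩ := hb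
  have h1 := ψ.map_add' ⟨a, ha⟩ ⟨b, hb⟩
  refine ⟨⟨add_nonneg ha hb, ?_⟩, ?_⟩
  · rw [h1]; exact ENNReal.add_lt_top.2 ⟨ha', hb'⟩
  · simp only [val, ha, hb, add_nonneg ha hb, dif_pos]
    rw [h1, ENNReal.toReal_add ha'.ne hb'.ne]

theorem FinPos.of_le {a b : A} (hb : ψ.FinPos b) (ha : 0 ≤ a) (hab : a ≤ b) : ψ.FinPos a := by
  obtain ⟨hb, hb'⟩ := hb
  refine ⟨ha, lt_of_le_of_lt ?_ hb'⟩
  have h1 := ψ.map_add' ⟨a, ha⟩ ⟨b - a, sub_nonneg.2 hab⟩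
  simp only [add_sub_cancel] at h1
  rw [h1]
  exact le_self_add

theorem FinPos.smul {a : A} (ha : ψ.FinPos a) {c : ℝ} (hc : 0 < c) :
    ψ.FinPos (c • a) ∧ ψ.val (c • a) = c * ψ.val a := by
  obtain ⟨ha, ha'⟩ := ha
  have h1 := ψ.map_smul' c hc ⟨a, ha⟩
  refine ⟨⟨smul_nonneg hc.le ha, ?_⟩, ?_⟩
  · rw [h1]; exact ENNReal.mul_lt_top ENNReal.ofReal_lt_top ha'
  · simp only [val, ha, smul_nonneg hc.le ha, dif_pos]
    rw [h1, ENNReal.toReal_mul, ENNReal.toReal_ofReal hc.le]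

theorem IsProper.finPos_zero (h : ψ.IsProper) : ψ.FinPos 0 ∧ ψ.val 0 = 0 := by
  obtain ⟨a, ha⟩ := h.dense.nonempty_iff.2 ⟨⟨0, le_rfl⟩⟩
  have h0 : ψ.FinPos 0 := FinPos.of_le ⟨a.2, ha⟩ le_rfl a.2
  refine ⟨h0, ?_⟩
  have := (h0.add h0).2
  rw [add_zero] at this
  linarith

variable (ψ) in
/-- Differences of positive elements of finite weight. -/
def FinDiff (r : A) (v : ℝ) : Prop :=
  ∃ p q, ψ.FinPos p ∧ ψ.FinPos q ∧ r = p - q ∧ v = ψ.val p - ψ.val q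

theorem FinDiff.unique {r : A} {v w : ℝ} (h1 : ψ.FinDiff r v) (h2 : ψ.FinDiff r w) : v = w := by
  obtain ⟨p, q, hp, hq, rfl, rfl⟩ := h1
  obtain ⟨p', q', hp', hq', e, rfl⟩ := h2
  have h3 := (hp.add hq').2
  rw [show p + q' = p' + q by rw [sub_eq_sub_iff_add_eq_add] at e; exact e, (hp'.add hq).2] at h3
  linarith

theorem FinDiff.add {r s : A} {v w : ℝ} (h1 : ψ.FinDiff r v) (h2 : ψ.FinDiff s w) :
    ψ.FinDiff (r + s) (v + w) := by
  obtain ⟨p, q, hp, hq, rfl, rfl⟩ := h1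
  obtain ⟨p', q', hp', hq', rfl, rfl⟩ := h2
  exact ⟨p + p', q + q', (hp.add hp').1, (hq.add hq').1, by abel,
    by rw [(hp.add hp').2, (hq.add hq').2]; ring⟩

theorem FinDiff.neg {r : A} {v : ℝ} (h1 : ψ.FinDiff r v) : ψ.FinDiff (-r) (-v) := by
  obtain ⟨p, q, hp, hq, rfl, rfl⟩ := h1
  exact ⟨q, p, hq, hp, by abel, by ring⟩

theorem FinDiff.smul (h : ψ.IsProper) {r : A} {v : ℝ} (h1 : ψ.FinDiff r v) (c : ℝ) :
    ψ.FinDiff (c • r) (c * v) := by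
  have main : ∀ c : ℝ, 0 < c → ψ.FinDiff (c • r) (c * v) := by
    intro c hc
    obtain ⟨p, q, hp, hq, rfl, rfl⟩ := h1
    exact ⟨c • p, c • q, (hp.smul hc).1, (hq.smul hc).1, smul_sub _ _ _,
      by rw [(hp.smul hc).2, (hq.smul hc).2]; ring⟩
  rcases lt_trichotomy c 0 with hc | rfl | hc
  · simpa using (main (-c) (by linarith)).neg
  · exact ⟨0, 0, h.finPos_zero.1, h.finPos_zero.1, by simp, by simp⟩
  · exact main c hc

theorem FinPos.finDiff (h : ψ.IsProper) {a : A} (ha : ψ.FinPos a) : ψ.FinDiff a (ψ.val a) :=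
  ⟨a, 0, ha, h.finPos_zero.1, by simp, by simp [h.finPos_zero.2]⟩

theorem sqFinite_iff {a : A} : a ∈ ψ.sqFinite ↔ ψ.FinPos (star a * a) :=
  ⟨fun h => ⟨star_mul_self_nonneg a, h⟩, fun h => h.2⟩

theorem sqFinite_add {a b : A} (ha : a ∈ ψ.sqFinite) (hb : b ∈ ψ.sqFinite) :
    a + b ∈ ψ.sqFinite := by
  rw [sqFinite_iff] at *
  refine FinPos.of_le ((ha.add ha).1.add (hb.add hb).1).1 (star_mul_self_nonneg _) ?_
  rw [← sub_nonneg]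
  convert star_mul_self_nonneg (a - b) using 1
  simp only [star_add, star_sub, add_mul, mul_add, sub_mul, mul_sub]
  abel

theorem sqFinite_smul {a : A} (ha : a ∈ ψ.sqFinite) {c : ℂ} (hc : conj c * c = 1) :
    c • a ∈ ψ.sqFinite := by
  rw [sqFinite_iff] at *
  convert ha using 1
  rw [star_smul, smul_mul_smul_comm]
  change (conj c * c) • _ = _
  rw [hc, one_smul]

open ComplexStarModule in
/-- Both the real and the imaginary part are differences of positive elements of finite weight. -/
theorem finDiff_of_mem_domain (h : ψ.IsProper) {x : A} (hx : x ∈ ψ.domain) :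
    (∃ v, ψ.FinDiff (ℜ x : A) v) ∧ ∃ w, ψ.FinDiff (ℑ x : A) w := by
  have mk : ∀ x r s : A, ∀ v w : ℝ, ψ.FinDiff r v → ψ.FinDiff s w → x = r + Complex.I • s →
      (∃ v, ψ.FinDiff (ℜ x : A) v) ∧ ∃ w, ψ.FinDiff (ℑ x : A) w := by
    intro x r s v w hr hs hx
    have sa : ∀ {r : A} {v : ℝ}, ψ.FinDiff r v → IsSelfAdjoint r := by
      rintro _ _ ⟨p, q, hp, hq, rfl, -⟩
      exact (IsSelfAdjoint.of_nonneg hp.1).sub (IsSelfAdjoint.of_nonneg hq.1)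
    have h1 : (ℜ x : A) = r := by
      rw [hx, map_add, realPart_I_smul, (sa hs).imaginaryPart, neg_zero, add_zero]
      exact (sa hr).coe_realPart
    have h2 : (ℑ x : A) = s := by
      rw [hx, map_add, imaginaryPart_I_smul, (sa hr).imaginaryPart, zero_add]
      exact (sa hs).coe_realPart
    rw [h1, h2]
    exact ⟨⟨v, hr⟩, ⟨w, hs⟩⟩
  induction hx using Submodule.span_induction with
  | mem x hx =>
    obtain ⟨a, ha, b, hb, rfl⟩ := hx
    have hI : ∀ c : ℂ, conj c * c = 1 → ψ.FinPos (star (b + c • a) * (b + c • a)) := fun c hc =>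
      sqFinite_iff.1 (sqFinite_add hb (sqFinite_smul ha hc))
    have p1 := hI 1 (by simp)
    have p2 := hI (-1) (by simp)
    have p3 := hI Complex.I (by simp)
    have p4 := hI (-Complex.I) (by simp)
    have d1 := ((p1.finDiff h).add (p2.finDiff h).neg).smul h (1 / 4)
    have d2 := ((p3.finDiff h).add (p4.finDiff h).neg).smul h (1 / 4)
    refine mk _ _ _ _ _ d1 d2 ?_
    simp only [one_smul, neg_smul, star_add, star_neg, star_smul, add_mul, mul_add, neg_mul,
      mul_neg, smul_mul_assoc, mul_smul_comm]
    have hI : star Complex.I = -Complex.I := Complex.conj_I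
    have hr : ∀ z : A, (1 / 4 : ℝ) • z = (1 / 4 : ℂ) • z := fun z => by
      rw [← Complex.coe_smul]; norm_num
    simp only [hI, hr]
    match_scalars <;> ring_nf <;> simp only [Complex.I_sq] <;> norm_num
  | zero => exact mk 0 0 0 _ _ (h.finPos_zero.1.finDiff h) (h.finPos_zero.1.finDiff h) (by simp)
  | add x y _ _ hx hy =>
    obtain ⟨⟨v, hv⟩, w, hw⟩ := hx
    obtain ⟨⟨v', hv'⟩, w', hw'⟩ := hy
    rw [map_add, map_add]
    exact ⟨⟨_, hv.add hv'⟩, ⟨_, hw.add hw'⟩⟩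
  | smul c x _ hx =>
    obtain ⟨⟨v, hv⟩, w, hw⟩ := hx
    rw [realPart_smul, imaginaryPart_smul]
    refine ⟨⟨c.re * v + -(c.im * w), ?_⟩, ⟨c.re * w + c.im * v, ?_⟩⟩
    · have := (hv.smul h c.re).add (hw.smul h c.im).neg
      simpa [sub_eq_add_neg] using this
    · have := (hw.smul h c.re).add (hv.smul h c.im)
      simpa using this

open ComplexStarModule in
/-- A proper weight extends to a linear functional on its domain. -/
theorem IsProper.exists_isExtension (h : ψ.IsProper) : ∃ L, ψ.IsExtension L := by
  choose v hv w hw using fun x : ψ.domain =>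
    (⟨_, (finDiff_of_mem_domain h x.2).1.choose_spec, _,
      (finDiff_of_mem_domain h x.2).2.choose_spec⟩ :
      ∃ v, ψ.FinDiff (ℜ (x : A) : A) v ∧ ∃ w, ψ.FinDiff (ℑ (x : A) : A) w)
  refine ⟨{ toFun := fun x => v x + w x * Complex.I, map_add' := ?_, map_smul' := ?_ }, ?_⟩
  · intro x y
    have h1 : v (x + y) = v x + v y := by
      refine (hv _).unique ?_
      rw [Submodule.coe_add, map_add]
      exact (hv x).add (hv y)
    have h2 : w (x + y) = w x + w y := by
      refine (hw _).unique ?_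
      rw [Submodule.coe_add, map_add]
      exact (hw x).add (hw y)
    rw [h1, h2]; push_cast; ring
  · intro c x
    have h1 : v (c • x) = c.re * v x + -(c.im * w x) := by
      refine (hv _).unique ?_
      rw [Submodule.coe_smul, realPart_smul]
      simpa [sub_eq_add_neg] using ((hv x).smul h c.re).add ((hw x).smul h c.im).neg
    have h2 : w (c • x) = c.re * w x + c.im * v x := by
      refine (hw _).unique ?_
      rw [Submodule.coe_smul, imaginaryPart_smul]
      simpa using ((hw x).smul h c.re).add ((hv x).smul h c.im)
    rw [h1, h2]
    apply Complex.ext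
    · simp; ring
    · simp
  · intro a ha
    have sa := IsSelfAdjoint.of_nonneg ha
    have h1 : ψ.FinDiff (a : A) (v a) := by simpa only [sa.coe_realPart] using hv a
    have h2 : ψ.FinDiff (0 : A) (w a) := by
      have := hw a
      rwa [sa.imaginaryPart] at this
    have hfin : ψ.FinPos (a : A) := by
      obtain ⟨p, q, hp, hq, e, -⟩ := h1
      exact hp.of_le ha (by rw [e]; exact sub_le_self _ hq.1)
    refine ⟨hfin.2, ?_⟩
    have e1 := h1.unique (hfin.finDiff h)
    have e2 := h2.unique (h.finPos_zero.1.finDiff h)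
    rw [h.finPos_zero.2] at e2
    simp [e1, e2, val, ha]

theorem FinPos.mem_domain {a : A} (ha : ψ.FinPos a) : a ∈ ψ.domain := by
  obtain ⟨b, rfl⟩ := CStarAlgebra.nonneg_iff_eq_star_mul_self.1 ha.1
  exact Submodule.subset_span ⟨b, sqFinite_iff.2 ha, b, sqFinite_iff.2 ha, rfl⟩

open ComplexStarModule in
/-- The linear extension of a proper weight to its domain is unique. -/
theorem IsExtension.unique (h : ψ.IsProper) {L L' : ψ.domain →ₗ[ℂ] ℂ} (hL : ψ.IsExtension L)
    (hL' : ψ.IsExtension L') : L = L' := by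
  have hp : ∀ {p : A} (hp : ψ.FinPos p), L ⟨p, hp.mem_domain⟩ = L' ⟨p, hp.mem_domain⟩ :=
    fun {p} hp => ((hL ⟨p, hp.mem_domain⟩ hp.1).2).trans ((hL' ⟨p, hp.mem_domain⟩ hp.1).2).symm
  refine LinearMap.ext fun x => ?_
  obtain ⟨⟨_, p, q, hp1, hq1, e1, -⟩, _, p', q', hp2, hq2, e2, -⟩ := finDiff_of_mem_domain h x.2
  have hx : x = (⟨p, hp1.mem_domain⟩ - ⟨q, hq1.mem_domain⟩) +
      Complex.I • ((⟨p', hp2.mem_domain⟩ : ψ.domain) - ⟨q', hq2.mem_domain⟩) := by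
    refine Subtype.ext ?_
    have := realPart_add_I_smul_imaginaryPart (x : A)
    rw [e1, e2] at this
    exact this.symm
  rw [hx]
  simp only [map_add, map_sub, map_smul, hp hp1, hp hq1, hp hp2, hp hq2]

variable (ψ) in
open Classical in
/-- The linear extension of a proper weight `ψ` to its domain, continued by zero to all of `A`. -/
noncomputable def linExt (a : A) : ℂ :=
  if h : a ∈ ψ.domain ∧ ∃ L, ψ.IsExtension L then h.2.choose ⟨a, h.1⟩ else 0

theorem linExt_eq (h : ψ.IsProper) {L : ψ.domain →ₗ[ℂ] ℂ} (hL : ψ.IsExtension L) (x : ψ.domain) :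
    ψ.linExt x = L x := by
  have h1 : (x : A) ∈ ψ.domain ∧ ∃ L, ψ.IsExtension L := ⟨x.2, L, hL⟩
  rw [linExt, dif_pos h1, IsExtension.unique h h1.2.choose_spec hL]

end CStarWeight

/-- A continuous one-parameter group of `*`-automorphisms. -/
structure OneParameterGroup (A : Type*) [NonUnitalCStarAlgebra A] where
  aut : ℝ → (A ≃⋆ₐ[ℂ] A)
  aut_add : ∀ s t a, aut (s + t) a = aut s (aut t a)
  continuous_aut : ∀ a, Continuous fun t => aut t a

/-- The closed strip of all complex numbers with imaginary part between `0` and `β`. -/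
def kmsStrip (β : ℝ) : Set ℂ := {z | z.im ∈ Set.uIcc 0 β}

/-- A proper weight `ψ` is a `β`-KMS weight for `α` when it is `α`-invariant and, for all `a, b`
such that `ψ` is finite at `a* a`, `a a*`, `b* b`, `b b*`, there is a continuous bounded function
on the strip, holomorphic in its interior, with boundary values `ψ (a α_t(b))` and
`ψ (α_t(b) a)`. By invariance the products `a α_t(b)` and `α_t(b) a` belong to `ψ.domain`. -/
structure IsKMSWeight {A : Type*} [NonUnitalCStarAlgebra A] [PartialOrder A] [StarOrderedRing A]
    (ψ : CStarWeight A) (α : OneParameterGroup A) (β : ℝ) : Prop where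
  proper : ψ.IsProper
  invariant : ∀ (t : ℝ) (a : {a : A // 0 ≤ a}),
    ψ.toFun ⟨α.aut t a, map_nonneg (α.aut t) a.2⟩ = ψ.toFun a
  kms : ∀ a b : A, a ∈ ψ.sqFinite → star a ∈ ψ.sqFinite → b ∈ ψ.sqFinite → star b ∈ ψ.sqFinite →
    ∃ F : ℂ → ℂ, ContinuousOn F (kmsStrip β) ∧ (∃ C, ∀ z ∈ kmsStrip β, ‖F z‖ ≤ C) ∧
      DifferentiableOn ℂ F (interior (kmsStrip β)) ∧
      ∀ t : ℝ, F t = ψ.linExt (a * α.aut t b) ∧ F (t + β * Complex.I) = ψ.linExt (α.aut t b * a)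

theorem IsKMSWeight.mul_mem_domain {A : Type*} [NonUnitalCStarAlgebra A] [PartialOrder A]
    [StarOrderedRing A] {ψ : CStarWeight A} {α : OneParameterGroup A} {β : ℝ}
    (h : IsKMSWeight ψ α β) {a b : A} (ha : a ∈ ψ.sqFinite) (ha' : star a ∈ ψ.sqFinite)
    (hb : b ∈ ψ.sqFinite) (hb' : star b ∈ ψ.sqFinite) (t : ℝ) :
    a * α.aut t b ∈ ψ.domain ∧ α.aut t b * a ∈ ψ.domain := by
  have inv : ∀ b ∈ ψ.sqFinite, α.aut t b ∈ ψ.sqFinite := by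
    intro b hb
    have h1 := h.invariant t ⟨star b * b, star_mul_self_nonneg b⟩
    simp only [map_mul, map_star] at h1
    change ψ.toFun _ < ∞
    rw [h1]
    exact hb
  have hs : star (α.aut t b) ∈ ψ.sqFinite := by rw [← map_star]; exact inv _ hb'
  exact ⟨Submodule.subset_span ⟨star a, ha', _, inv b hb, by rw [star_star]⟩,
    Submodule.subset_span ⟨_, hs, a, ha, by rw [star_star]⟩⟩

namespace EtaleGroupoid

variable {G : Type u} {X : Type v} [TopologicalSpace G] [TopologicalSpace X]
  (𝒢 : EtaleGroupoid G X)

/-- A weight on the reduced groupoid `C*`-algebra is diagonal when it has the form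
`a ↦ ∫ P(a) dm`, where `P` is the canonical conditional expectation onto `C_0` of the unit space
and `m` is a regular Borel measure on the unit space. -/
def IsDiagonalWeight [T2Space G] [LocallyCompactSpace G] [MeasurableSpace X] [BorelSpace X]
    (ψ : CStarWeight 𝒢.ReducedCStar) : Prop :=
  ∃ m : MeasureTheory.Measure X, m.Regular ∧
    ∀ a, ψ.toFun a = ∫⁻ x, ENNReal.ofReal (𝒢.expect a x).re ∂m

/-- A groupoid is minimal when `src (rng⁻¹ {y})` is dense in the unit space for all `y`. -/
def IsMinimal : Prop := ∀ y, Dense (𝒢.src '' (𝒢.rng ⁻¹' {y}))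

/-- The unit `x` has trivial isotropy group. -/
def TrivialIsotropy (x : X) : Prop := ∀ g, 𝒢.rng g = x → 𝒢.src g = x → g = 𝒢.unit x

/-- A homomorphism from a groupoid to the additive group of real numbers. -/
def IsHom (c : G → ℝ) : Prop := ∀ g h hgh, c (𝒢.mul g h hgh) = c g + c h

end EtaleGroupoid

/-- The function `ξ ↦ exp(i t c(ξ)) f(ξ)` in `C_c(G)`. -/
noncomputable def expMul {G : Type*} [TopologicalSpace G] (c : C(G, ℝ)) (t : ℝ) (f : C_c(G, ℂ)) :
    C_c(G, ℂ) where
  toFun ξ := Complex.exp (Complex.I * t * c ξ) * f ξ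
  continuous_toFun := by fun_prop
  hasCompactSupport' := f.hasCompactSupport.mul_left

/-! ### Bounded holomorphic functions on a strip -/

section Strip

open Complex Set Filter

/-! Let ψ be the diagonal KMS weight, given by the measure m. The proof has two halves: ψ forces α
to fix the functions on the unit space, and the groupoid structure then forces α to act by a scalar
at every arrow.

First half. If a non-empty open set is m-null, take a function f supported on arrows starting in
that set. The KMS function of f* and f vanishes on the real line, so it vanishes on the other edge
of the strip (`eq_zero_of_boundary_eq_zero`), which says that ψ(f f*) = 0. By minimality such arrows
reach every unit, so m would vanish near every unit and ψ would be zero. Hence m has full support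
(`isOpenPosMeasure_of_isKMSWeight`) and ψ is faithful. A function d on the units satisfies P(da) =
P(ad), so its KMS functions take the same values on both edges and are therefore constant
(`eq_const_of_boundary_periodic`). This gives ψ((α_t(d) - d)*(α_t(d) - d)) = 0, and so α_t(d) = d by
faithfulness (`aut_ofCc_unit`).

Second half. Since α fixes functions on the units, it commutes with cutting f down near the range
and the source of an arrow g. When the source of g has trivial isotropy, g is the only arrow with
its range and source, so the cut-down isolates g, and α_t(f)(g) vanishes whenever f(g) does
(`FixesUnits.coeff_aut_eq_zero`). Such arrows are dense (`dense_trivialIsotropy`), so by continuity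
α_t multiplies by a scalar `factor α t g` at every arrow. In t this is a bounded continuous
one-parameter group of scalars, hence exp(itc(g)). Joint continuity makes c continuous, and
multiplicativity of α_t makes c a homomorphism. -/

theorem kmsStrip_of_pos {β : ℝ} (hβ : 0 < β) : kmsStrip β = {z | z.im ∈ Icc 0 β} := by
  rw [kmsStrip, uIcc_of_le hβ.le]

theorem ioo_subset_interior_kmsStrip {β : ℝ} (hβ : 0 < β) :
    im ⁻¹' Ioo 0 β ⊆ interior (kmsStrip β) := by
  refine interior_maximal ?_ (isOpen_Ioo.preimage continuous_im)
  rw [kmsStrip_of_pos hβ]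
  exact fun z hz => Ioo_subset_Icc_self hz

/-- Boundary behaviour of bounded holomorphic functions on a strip can be reflected in the origin,
which reduces the case of a negative height to that of a positive one. -/
theorem kmsStrip_reflect {β : ℝ} {F : ℂ → ℂ} (hc : ContinuousOn F (kmsStrip β))
    (hb : ∃ C, ∀ z ∈ kmsStrip β, ‖F z‖ ≤ C) (hd : DifferentiableOn ℂ F (interior (kmsStrip β))) :
    ContinuousOn (fun z => F (-z)) (kmsStrip (-β)) ∧
      (∃ C, ∀ z ∈ kmsStrip (-β), ‖F (-z)‖ ≤ C) ∧
      DifferentiableOn ℂ (fun z => F (-z)) (interior (kmsStrip (-β))) := by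
  have hm : MapsTo (fun z : ℂ => -z) (kmsStrip (-β)) (kmsStrip β) := by
    intro z hz
    rw [kmsStrip, mem_ofPred_eq, mem_uIcc] at *
    rw [neg_im]
    rcases hz with h | h
    · right; constructor <;> linarith
    · left; constructor <;> linarith
  have hm' : MapsTo (fun z : ℂ => -z) (interior (kmsStrip (-β))) (interior (kmsStrip β)) := by
    have : interior (kmsStrip (-β)) ⊆ (fun z : ℂ => -z) ⁻¹' interior (kmsStrip β) := by
      rw [show (fun z : ℂ => -z) ⁻¹' interior (kmsStrip β) =
        interior ((fun z : ℂ => -z) ⁻¹' kmsStrip β) from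
          (Homeomorph.neg ℂ).preimage_interior _]
      exact interior_mono hm
    exact this
  obtain ⟨C, hC⟩ := hb
  exact ⟨hc.comp continuous_neg.continuousOn hm, ⟨C, fun z hz => hC _ (hm hz)⟩,
    hd.comp differentiable_neg.differentiableOn hm'⟩

/-- The factor exp(iNz) has modulus exp(-N Im z). Phragmén–Lindelöf applied to F(z) exp(iNz), which
is zero on the lower edge and at most C exp(-Nβ) on the upper one, gives |F(t + iy)| ≤ C exp(-N(β -
y)). Letting N grow kills F below the upper edge, and continuity does the rest. -/
theorem eq_zero_of_boundary_eq_zero_of_pos {β : ℝ} (hβ : 0 < β) {F : ℂ → ℂ}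
    (hc : ContinuousOn F (kmsStrip β)) (hb : ∃ C, ∀ z ∈ kmsStrip β, ‖F z‖ ≤ C)
    (hd : DifferentiableOn ℂ F (interior (kmsStrip β))) (h0 : ∀ t : ℝ, F t = 0) (t : ℝ) :
    F (t + β * I) = 0 := by
  rw [kmsStrip_of_pos hβ] at hc hb
  obtain ⟨C, hC⟩ := hb
  have hd' := hd.mono (ioo_subset_interior_kmsStrip hβ)
  have key : ∀ N : ℕ, ∀ y ∈ Icc 0 β,
      ‖F (t + y * I) * exp (N * I * (t + y * I))‖ ≤ C * Real.exp (-(N * β)) := by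
    intro N y hy
    have hE : ∀ z : ℂ, ‖exp (N * I * z)‖ = Real.exp (-(N * z.im)) := fun z => by
      rw [norm_exp]; simp
    refine PhragmenLindelof.horizontal_strip (a := 0) (b := β)
      (f := fun z => F z * exp (N * I * z)) (z := t + y * I) ⟨?_, ?_⟩ ?_ ?_ ?_ ?_ ?_
    · exact hd'.mul (by fun_prop)
    · refine ContinuousOn.mono (hc.mul (by fun_prop)) ?_
      refine (closure_minimal (t := im ⁻¹' Icc 0 β) (preimage_mono Ioo_subset_Icc_self)
        (isClosed_Icc.preimage continuous_im)).trans (fun z hz => hz)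
    -- The product is bounded on the strip, so the growth condition holds with both constants zero.
    · refine ⟨0, by rw [sub_zero]; positivity, 0, ?_⟩
      refine Asymptotics.IsBigO.of_bound (max C 0) ?_
      refine eventually_inf_principal.2 (Eventually.of_forall fun z hz => ?_)
      rw [norm_mul, hE]
      have h1 : ‖F z‖ ≤ max C 0 := (hC z (Ioo_subset_Icc_self hz)).trans (le_max_left _ _)
      have h2 : Real.exp (-(N * z.im)) ≤ 1 := by
        rw [Real.exp_le_one_iff, neg_nonpos]
        exact mul_nonneg (Nat.cast_nonneg _) hz.1.le
      simpa using mul_le_mul h1 h2 (Real.exp_pos _).le (le_max_right _ _)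
    · intro z hz
      have : z = (z.re : ℂ) := Complex.ext rfl (by simpa using hz)
      rw [this, h0, zero_mul, norm_zero]
      have : 0 ≤ C := (norm_nonneg _).trans (hC 0 (by simp [hβ.le]))
      positivity
    · intro z hz
      rw [norm_mul, hE, hz]
      gcongr
      exact hC z (by simp [hz, hβ.le])
    · simpa using hy.1
    · simpa using hy.2
  have hint : ∀ y ∈ Ico 0 β, F (t + y * I) = 0 := by
    intro y hy
    have h1 : ∀ N : ℕ, ‖F (t + y * I)‖ ≤ C * Real.exp (-((β - y) * N)) := by
      intro N
      have h2 := key N y (Ico_subset_Icc_self hy)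
      rw [norm_mul, norm_exp] at h2
      have h3 : (N * I * (t + y * I) : ℂ).re = -(N * y) := by simp
      rw [h3, ← le_div_iff₀ (Real.exp_pos _)] at h2
      rw [mul_div_assoc, ← Real.exp_sub] at h2
      rwa [show -((β - y) * N) = -(N * β) - -(N * y) by ring]
    have h2 : Tendsto (fun N : ℕ => C * Real.exp (-((β - y) * N))) atTop (nhds (C * 0)) := by
      refine Tendsto.const_mul _ (Real.tendsto_exp_neg_atTop_nhds_zero.comp ?_)
      exact tendsto_natCast_atTop_atTop.const_mul_atTop (sub_pos.2 hy.2)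
    rw [mul_zero] at h2
    exact norm_le_zero_iff.1 (ge_of_tendsto' h2 h1)
  have hcl : ContinuousOn (fun y : ℝ => F (t + y * I)) (Icc 0 β) :=
    hc.comp (by fun_prop) (fun y hy => by simpa using hy)
  have h2 : EqOn (fun y : ℝ => F (t + y * I)) 0 (Icc 0 β) := by
    refine EqOn.of_subset_closure (s := Ico 0 β) hint hcl continuousOn_const
      Ico_subset_Icc_self ?_
    rw [closure_Ico hβ.ne]
  exact h2 ⟨hβ.le, le_rfl⟩

theorem eq_zero_of_boundary_eq_zero {β : ℝ} (hβ : β ≠ 0) {F : ℂ → ℂ}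
    (hc : ContinuousOn F (kmsStrip β)) (hb : ∃ C, ∀ z ∈ kmsStrip β, ‖F z‖ ≤ C)
    (hd : DifferentiableOn ℂ F (interior (kmsStrip β))) (h0 : ∀ t : ℝ, F t = 0) (t : ℝ) :
    F (t + β * I) = 0 := by
  rcases lt_or_gt_of_ne hβ with h | h
  · obtain ⟨h1, h2, h3⟩ := kmsStrip_reflect hc hb hd
    have := eq_zero_of_boundary_eq_zero_of_pos (neg_pos.2 h) h1 h2 h3
      (fun t => by simpa using h0 (-t)) (-t)
    rw [← this]
    congr 1
    push_cast
    ring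
  · exact eq_zero_of_boundary_eq_zero_of_pos h hc hb hd h0 t

/-- In place of a periodic extension and Liouville's theorem, this expands F in a Fourier series on
each vertical segment. Cauchy's theorem ties the n-th coefficient at real part x to the one at 0 by
the factor exp(2πnx/β). Boundedness of F then leaves only n = 0, whose coefficient does not depend
on x. -/
theorem eq_const_of_boundary_periodic_of_pos {β : ℝ} (hβ : 0 < β) {F : ℂ → ℂ}
    (hc : ContinuousOn F (kmsStrip β)) (hb : ∃ C, ∀ z ∈ kmsStrip β, ‖F z‖ ≤ C)
    (hd : DifferentiableOn ℂ F (interior (kmsStrip β)))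
    (h0 : ∀ t : ℝ, F (t + β * I) = F t) (t : ℝ) : F t = F 0 := by
  rw [kmsStrip_of_pos hβ] at hc hb
  obtain ⟨M, hM⟩ := hb
  have hd' := hd.mono (ioo_subset_interior_kmsStrip hβ)
  have hβ' : (β : ℂ) ≠ 0 := ofReal_ne_zero.2 hβ.ne'
  have hfact : Fact (0 < β) := ⟨hβ⟩
  set c : ℤ → ℝ → ℂ := fun n x => fourierCoeff (AddCircle.liftIco β 0 fun y : ℝ => F (x + y * I)) n
    with hcdef
  have hcoef : ∀ n x, c n x =
      (1 / β) • ∫ y in (0 : ℝ)..β, exp (2 * Real.pi * I * (-n : ℤ) * y / β) * F (x + y * I) := by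
    intro n x
    rw [hcdef]
    simp only
    rw [fourierCoeff_liftIco_eq, fourierCoeffOn_eq_integral]
    simp only [zero_add, sub_zero, smul_eq_mul, fourier_coe_apply]
  -- the integral over the vertical segment does not depend on its real part
  have hint : ∀ (n : ℤ) (x : ℝ), ∫ y in (0 : ℝ)..β,
      F (x + y * I) * exp (-(2 * Real.pi * n / β) * (x + y * I)) =
        exp (-(2 * Real.pi * n / β) * x) * (β * c n x) := by
    intro n x
    rw [hcoef, real_smul]
    push_cast
    rw [← mul_assoc (β : ℂ), mul_one_div_cancel hβ', one_mul,
      ← intervalIntegral.integral_const_mul]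
    congr 1
    funext y
    rw [mul_left_comm, mul_comm (F _), ← mul_assoc, ← exp_add]
    congr 2
    ring
  have hindep : ∀ (n : ℤ) (x : ℝ), exp (-(2 * Real.pi * n / β) * x) * (β * c n x) = β * c n 0 := by
    intro n x
    set E : ℂ → ℂ := fun z => F z * exp (-(2 * Real.pi * n / β) * z) with hE
    have hrect := integral_boundary_rect_eq_zero_of_continuousOn_of_differentiableOn E 0
      (x + β * I) ?_ ?_
    · simp only [zero_re, zero_im, add_re, add_im, ofReal_re, ofReal_im, mul_re, mul_im, I_re, I_im,
        mul_zero, mul_one, sub_zero, add_zero, zero_add, ofReal_zero, zero_mul] at hrect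
      -- The exponential factor has period iβ, so the two horizontal sides of the rectangle cancel.
      have h1 : ∀ s : ℝ, E (s + β * I) = E s := by
        intro s
        simp only [hE]
        rw [h0]
        congr 1
        rw [show -(2 * Real.pi * n / β) * (s + β * I) =
          -(2 * Real.pi * n / β) * s + (-n : ℤ) * (2 * Real.pi * I) by
            push_cast; field_simp; ring, exp_add, exp_int_mul_two_pi_mul_I, mul_one]
      simp only [h1, sub_self, zero_add, smul_eq_mul] at hrect
      rw [← mul_sub, mul_eq_zero, or_iff_right I_ne_zero, sub_eq_zero] at hrect
      rw [← hint, show β * c n 0 = exp (-(2 * Real.pi * n / β) * (0 : ℝ)) * (β * c n 0) by simp,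
        ← hint]
      simpa [hE] using hrect
    · refine ContinuousOn.mono (hc.mul (by fun_prop)) ?_
      intro z hz
      have := hz.2
      simpa [uIcc_of_le hβ.le] using this
    · refine DifferentiableOn.mono (hd'.mul (by fun_prop)) ?_
      intro z hz
      have := hz.2
      simpa [min_eq_left hβ.le, max_eq_right hβ.le] using this
  have hbd : ∀ (n : ℤ) (x : ℝ), ‖β * c n x‖ ≤ M * β := by
    intro n x
    rw [hcoef, real_smul]
    push_cast
    rw [← mul_assoc (β : ℂ), mul_one_div_cancel hβ', one_mul]
    have := intervalIntegral.norm_integral_le_of_norm_le_const (a := 0) (b := β) (C := M)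
      (f := fun y : ℝ => exp (2 * Real.pi * I * (-n : ℤ) * y / β) * F (x + y * I)) ?_
    · simpa [abs_of_pos hβ] using this
    · intro y hy
      rw [uIoc_of_le hβ.le] at hy
      rw [norm_mul, show 2 * Real.pi * I * (-n : ℤ) * y / β =
        (2 * Real.pi * (-n : ℤ) * y / β : ℝ) * I by push_cast; ring, norm_exp_ofReal_mul_I, one_mul]
      exact hM _ (by simpa using Ioc_subset_Icc_self hy)
  have hzero : ∀ n : ℤ, n ≠ 0 → ∀ x, c n x = 0 := by
    intro n hn
    have h1 : ∀ x : ℝ, ‖β * c n 0‖ ≤ Real.exp (-((2 * Real.pi * n / β) * x)) * (M * β) := by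
      intro x
      rw [← hindep n x, norm_mul, norm_exp]
      have : (-(2 * Real.pi * n / β) * x : ℂ).re = -((2 * Real.pi * n / β) * x) := by
        rw [← neg_mul, ← ofReal_re (-(2 * Real.pi * n / β) * x)]
        push_cast
        rfl
      rw [this]
      gcongr
      exact hbd n x
    have hk : (2 * Real.pi * n / β : ℝ) ≠ 0 := by
      have := Real.pi_ne_zero
      have : (n : ℝ) ≠ 0 := Int.cast_ne_zero.2 hn
      positivity
    have h2 : ∀ N : ℕ, ‖β * c n 0‖ ≤ Real.exp (-(N : ℝ)) * (M * β) := by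
      intro N
      -- This point tends to plus or minus infinity according to the sign of n, so that the exponent
      -- is always -N.
      have := h1 (N / (2 * Real.pi * n / β))
      rwa [mul_div_cancel₀ _ hk] at this
    have h3 : Tendsto (fun N : ℕ => Real.exp (-(N : ℝ)) * (M * β)) atTop (nhds (0 * (M * β))) :=
      (Real.tendsto_exp_neg_atTop_nhds_zero.comp tendsto_natCast_atTop_atTop).mul_const _
    rw [zero_mul] at h3
    have h4 := norm_le_zero_iff.1 (ge_of_tendsto' h3 h2)
    intro x
    have h5 := hindep n x
    rw [h4, mul_eq_zero, or_iff_right (exp_ne_zero _), mul_eq_zero, or_iff_right hβ'] at h5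
    exact h5
  have hval : ∀ x : ℝ, F x = c 0 x := by
    intro x
    -- Equality of F on the two edges is what makes the function continuous on the circle; its
    -- Fourier series is then evaluated at the base point y = 0.
    have hcont : Continuous (AddCircle.liftIco β 0 fun y : ℝ => F (x + y * I)) := by
      refine AddCircle.liftIco_zero_continuous (by simpa using (h0 x).symm) ?_
      exact hc.comp (by fun_prop) (fun y hy => by simpa using hy)
    have hs : ∀ n ∉ ({0} : Finset ℤ), c n x = 0 := fun n hn => hzero n (by simpa using hn) x
    have h1 := has_pointwise_sum_fourier_series_of_summable (T := β) (f := ⟨_, hcont⟩)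
      (summable_of_ne_finset_zero (s := {0}) hs) ((0 : ℝ) : AddCircle β)
    have h2 : HasSum (fun n : ℤ => c n x • fourier n ((0 : ℝ) : AddCircle β))
        (∑ n ∈ {0}, c n x • fourier n ((0 : ℝ) : AddCircle β)) :=
      hasSum_sum_of_ne_finset_zero fun n hn => by rw [hs n hn, zero_smul]
    have h3 := h1.unique h2
    rw [ContinuousMap.coe_mk, AddCircle.liftIco_coe_apply (by simp [hβ])] at h3
    simpa using h3
  have h1 := hindep 0 t
  simp only [Int.cast_zero, mul_zero, zero_div, neg_zero, zero_mul, exp_zero, one_mul] at h1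
  rw [hval, mul_left_cancel₀ hβ' h1]
  simpa using (hval 0).symm

theorem eq_const_of_boundary_periodic {β : ℝ} (hβ : β ≠ 0) {F : ℂ → ℂ}
    (hc : ContinuousOn F (kmsStrip β)) (hb : ∃ C, ∀ z ∈ kmsStrip β, ‖F z‖ ≤ C)
    (hd : DifferentiableOn ℂ F (interior (kmsStrip β)))
    (h0 : ∀ t : ℝ, F (t + β * I) = F t) (t : ℝ) : F t = F 0 := by
  rcases lt_or_gt_of_ne hβ with h | h
  · obtain ⟨h1, h2, h3⟩ := kmsStrip_reflect hc hb hd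
    have := eq_const_of_boundary_periodic_of_pos (neg_pos.2 h) h1 h2 h3
      (fun t => by
        rw [← Complex.ofReal_neg t, ← h0 (-t)]
        congr 1
        push_cast
        ring) (-t)
    simpa using this
  · exact eq_const_of_boundary_periodic_of_pos h hc hb hd h0 t

end Strip

namespace EtaleGroupoid

open Set Filter Topology

variable {G : Type u} {X : Type v} [TopologicalSpace G] [TopologicalSpace X]
  (𝒢 : EtaleGroupoid G X)

/-! Topology of an étale groupoid. -/

theorem isLocalHomeomorph_src : IsLocalHomeomorph 𝒢.src := by
  have : 𝒢.src = 𝒢.rng ∘ 𝒢.invHomeo := funext fun g => (𝒢.rng_inv g).symm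
  rw [this]
  exact 𝒢.isLocalHomeomorph_rng.comp 𝒢.invHomeo.isLocalHomeomorph

/-- The set of units inside the space of arrows. -/
def unitSet : Set G := {g | g = 𝒢.unit (𝒢.rng g)}

theorem unit_mem_unitSet (x : X) : 𝒢.unit x ∈ 𝒢.unitSet := by
  change _ = _
  rw [𝒢.rng_unit]

theorem inv_unit (x : X) : 𝒢.inv (𝒢.unit x) = 𝒢.unit x :=
  𝒢.inv_eq_of_mul _ _ ((𝒢.src_unit x).trans (𝒢.rng_unit x).symm) x (𝒢.mul_unit' _ _ _)

theorem involution_supported_unitSet {d : C_c(G, ℂ)} (hd : ∀ g, d g ≠ 0 → g ∈ 𝒢.unitSet) (g : G)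
    (hg : 𝒢.involution d g ≠ 0) : g ∈ 𝒢.unitSet := by
  rw [involution_apply] at hg
  have h1 : 𝒢.inv g = 𝒢.unit _ := hd (𝒢.inv g) (fun h => hg (by rw [h, map_zero]))
  rw [← 𝒢.inv_inv g, h1, 𝒢.inv_unit]
  exact 𝒢.unit_mem_unitSet _

/-- For k near a unit, both k and `unit (rng k)` lie in a set where the range map is injective. They
have the same range, so they coincide. -/
theorem isOpen_unitSet : IsOpen 𝒢.unitSet := by
  rw [isOpen_iff_mem_nhds]
  intro g hg
  obtain ⟨e, he, hr⟩ := 𝒢.isLocalHomeomorph_rng g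
  have hc : Continuous fun k => 𝒢.unit (𝒢.rng k) := 𝒢.continuous_unit.comp 𝒢.continuous_rng
  have h1 : (fun k => 𝒢.unit (𝒢.rng k)) ⁻¹' e.source ∈ 𝓝 g := by
    refine (e.open_source.preimage hc).mem_nhds ?_
    change 𝒢.unit (𝒢.rng g) ∈ e.source
    rwa [← show g = 𝒢.unit (𝒢.rng g) from hg]
  filter_upwards [h1, e.open_source.mem_nhds he] with k hk hk'
  refine e.injOn hk' hk ?_
  rw [← hr]
  exact (𝒢.rng_unit _).symm

/-- Every arrow has an open neighbourhood on which both the range and the source map are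
injective. -/
theorem exists_isOpen_bisection (g : G) :
    ∃ V, IsOpen V ∧ g ∈ V ∧ InjOn 𝒢.rng V ∧ InjOn 𝒢.src V := by
  obtain ⟨e, he, hr⟩ := 𝒢.isLocalHomeomorph_rng g
  obtain ⟨e', he', hs⟩ := 𝒢.isLocalHomeomorph_src g
  refine ⟨e.source ∩ e'.source, e.open_source.inter e'.open_source, ⟨he, he'⟩, ?_, ?_⟩
  · rw [hr]
    exact e.injOn.mono inter_subset_left
  · rw [hs]
    exact e'.injOn.mono inter_subset_right

/-- The quotient g⁻¹h is an isotropy element at the source of g. -/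
theorem eq_of_trivialIsotropy {g h : G} (hx : 𝒢.TrivialIsotropy (𝒢.src g))
    (hr : 𝒢.rng g = 𝒢.rng h) (hs : 𝒢.src g = 𝒢.src h) : g = h := by
  have h1 := hx (𝒢.ldiv g h hr) (𝒢.rng_ldiv _ _ _) ((𝒢.src_ldiv _ _ _).trans hs.symm)
  have h2 := 𝒢.mul_ldiv g h hr
  rw [𝒢.mul_congr _ rfl h1, 𝒢.mul_unit'] at h2
  exact h2

/-- Conjugation by g carries isotropy at its source to isotropy at its range. -/
theorem TrivialIsotropy.src_of_rng {𝒢 : EtaleGroupoid G X} {g : G}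
    (hx : 𝒢.TrivialIsotropy (𝒢.rng g)) : 𝒢.TrivialIsotropy (𝒢.src g) := by
  intro h hr hs
  have h1 := hx (𝒢.rdiv (𝒢.mul g h hr.symm) g ((𝒢.src_mul _ _ _).trans hs))
    ((𝒢.rng_rdiv _ _ _).trans (𝒢.rng_mul _ _ _)) (𝒢.src_rdiv _ _ _)
  have h2 := 𝒢.rdiv_mul (𝒢.mul g h hr.symm) g ((𝒢.src_mul _ _ _).trans hs)
  rw [𝒢.mul_congr _ h1 rfl, 𝒢.unit_mul'] at h2
  have h3 := 𝒢.ldiv_mul g h hr.symm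
  rw [← h3]
  simp only [← h2]
  exact 𝒢.inv_mul g

/-- In a minimal étale groupoid with a unit of trivial isotropy, the arrows whose source has
trivial isotropy are dense. -/
theorem dense_trivialIsotropy (htriv : ∃ x : X, 𝒢.TrivialIsotropy x) (hmin : 𝒢.IsMinimal) :
    Dense {g | 𝒢.TrivialIsotropy (𝒢.src g)} := by
  obtain ⟨x, hx⟩ := htriv
  have h1 : Dense {y | 𝒢.TrivialIsotropy y} := by
    -- The orbit of x is dense by minimality and consists of units with trivial isotropy; openness
    -- of the source map then lifts density to arrows.
    refine (hmin x).mono ?_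
    rintro _ ⟨g, rfl, rfl⟩
    exact hx.src_of_rng
  exact h1.preimage 𝒢.isLocalHomeomorph_src.isOpenMap

end EtaleGroupoid

/-- Bump functions on a locally compact Hausdorff space. -/
theorem exists_bump {G : Type*} [TopologicalSpace G] [T2Space G] [LocallyCompactSpace G] (g : G)
    {U : Set G} (hU : IsOpen U) (hg : g ∈ U) :
    ∃ f : C_c(G, ℂ), f g = 1 ∧ (∀ k, ‖f k‖ ≤ 1) ∧ ∀ k, f k ≠ 0 → k ∈ U := by
  obtain ⟨f, h1, h0, hc, hb⟩ := exists_continuous_one_zero_of_isCompact (isCompact_singleton (x := g))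
    hU.isClosed_compl (by simpa using hg)
  refine ⟨⟨⟨fun k => (f k : ℂ), by fun_prop⟩, hc.comp_left (g := Complex.ofReal) rfl⟩, ?_, ?_, ?_⟩
  · change (f g : ℂ) = 1
    rw [h1 rfl]; simp
  · intro k
    change ‖(f k : ℂ)‖ ≤ 1
    rw [Complex.norm_real, Real.norm_of_nonneg (hb k).1]
    exact (hb k).2
  · intro k hk
    by_contra hkU
    refine hk ?_
    change (f k : ℂ) = 0
    rw [h0 hkU]; simp

namespace EtaleGroupoid

open Set Filter Topology

variable {G : Type u} {X : Type v} [TopologicalSpace G] [TopologicalSpace X]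
  (𝒢 : EtaleGroupoid G X) [T2Space G] [LocallyCompactSpace G]

/-! Matrix coefficients of elements of the reduced `C*`-algebra. -/

open Classical in
/-- The value at the arrow `g` of the function on `G` that represents `a`. -/
noncomputable def coeff (a : 𝒢.ReducedCStar) (g : G) : ℂ :=
  a.1.op (𝒢.src g) (lp.single 2 (⟨𝒢.unit (𝒢.src g), 𝒢.src_unit _⟩ : 𝒢.SrcFiber (𝒢.src g)) 1) ⟨g, rfl⟩

theorem coeff_add (a b : 𝒢.ReducedCStar) (g : G) :
    𝒢.coeff (a + b) g = 𝒢.coeff a g + 𝒢.coeff b g := rfl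

theorem coeff_sub (a b : 𝒢.ReducedCStar) (g : G) :
    𝒢.coeff (a - b) g = 𝒢.coeff a g - 𝒢.coeff b g := rfl

theorem coeff_smul (c : ℂ) (a : 𝒢.ReducedCStar) (g : G) :
    𝒢.coeff (c • a) g = c * 𝒢.coeff a g := rfl

theorem norm_op_le (a : 𝒢.ReducedCStar) (x : X) : ‖a.1.op x‖ ≤ ‖a‖ :=
  lp.norm_apply_le_norm (E := fun x : X => 𝒢.Hilb x →L[ℂ] 𝒢.Hilb x) ENNReal.top_ne_zero a.1 x

open Classical in
theorem norm_op_single_le (a : 𝒢.ReducedCStar) (x : X) (k g : 𝒢.SrcFiber x) :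
    ‖a.1.op x (lp.single 2 k 1) g‖ ≤ ‖a‖ := by
  refine (lp.norm_apply_le_norm two_ne_zero _ _).trans ((ContinuousLinearMap.le_opNorm _ _).trans ?_)
  rw [lp.norm_single (by simp), norm_one, mul_one]
  exact 𝒢.norm_op_le a x

theorem norm_coeff_le (a : 𝒢.ReducedCStar) (g : G) : ‖𝒢.coeff a g‖ ≤ ‖a‖ :=
  𝒢.norm_op_single_le a _ _ _

theorem coeff_ofCc (f : C_c(G, ℂ)) (g : G) : 𝒢.coeff (𝒢.ofCc f) g = f g := by
  refine (𝒢.regRep_single (𝒢.src g) f ⟨g, rfl⟩ ⟨𝒢.unit (𝒢.src g), 𝒢.src_unit _⟩).trans ?_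
  congr 1
  have h1 := 𝒢.mul_rdiv g (𝒢.unit (𝒢.src g)) (𝒢.rng_unit _).symm
  simpa only [𝒢.mul_unit] using h1

theorem coeff_eq_expect (a : 𝒢.ReducedCStar) (x : X) :
    𝒢.coeff a (𝒢.unit x) = 𝒢.expect a x := by
  classical
  -- The two fibres lie over `src (unit x)` and `x`, which are equal only propositionally, so the
  -- base point is generalised before it is substituted.
  have h : ∀ y, y = x → ∀ h : 𝒢.src (𝒢.unit x) = y,
      a.1.op y (lp.single 2 (⟨𝒢.unit y, 𝒢.src_unit _⟩ : 𝒢.SrcFiber y) 1) ⟨𝒢.unit x, h⟩ =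
        𝒢.expect a x := by
    rintro y rfl h
    rfl
  exact h _ (𝒢.src_unit x) rfl

theorem continuous_coeff (a : 𝒢.ReducedCStar) : Continuous (𝒢.coeff a) := by
  refine continuous_of_uniform_approx_of_continuous fun u hu => ?_
  obtain ⟨ε, hε, hu⟩ := Metric.mem_uniformity_dist.1 hu
  obtain ⟨f, hf⟩ := 𝒢.exists_norm_sub_ofCc_lt a hε
  refine ⟨f, f.continuous, fun x => hu ?_⟩
  rw [← 𝒢.coeff_ofCc, dist_eq_norm, ← coeff_sub]
  exact (𝒢.norm_coeff_le _ x).trans_lt hf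

/-- The coefficient at an arrow as a continuous linear functional. -/
noncomputable def coeffL (g : G) : 𝒢.ReducedCStar →L[ℂ] ℂ :=
  LinearMap.mkContinuous
    { toFun := fun a => 𝒢.coeff a g
      map_add' := fun a b => 𝒢.coeff_add a b g
      map_smul' := fun c a => 𝒢.coeff_smul c a g } 1
    (fun a => by rw [one_mul]; exact 𝒢.norm_coeff_le a g)

theorem coeffL_apply (g : G) (a : 𝒢.ReducedCStar) : 𝒢.coeffL g a = 𝒢.coeff a g := rfl

/-- Continuous functions on the reduced `C*`-algebra that agree on `C_c(G)` are equal. -/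
theorem eq_of_eq_ofCc {Y : Type*} [TopologicalSpace Y] [T2Space Y] {φ χ : 𝒢.ReducedCStar → Y}
    (hφ : Continuous φ) (hχ : Continuous χ) (h : ∀ f, φ (𝒢.ofCc f) = χ (𝒢.ofCc f))
    (a : 𝒢.ReducedCStar) : φ a = χ a := by
  have hd : DenseRange 𝒢.ofCc := by
    intro a
    rw [Metric.mem_closure_iff]
    intro ε hε
    obtain ⟨f, hf⟩ := 𝒢.exists_norm_sub_ofCc_lt a hε
    exact ⟨_, ⟨f, rfl⟩, by rwa [dist_eq_norm]⟩
  exact congrFun (hd.equalizer hφ hχ (funext h)) a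

open Classical in
/-- The matrix entry of `a` at a pair of arrows, as a continuous linear functional. -/
noncomputable def entryL (x : X) (k g : 𝒢.SrcFiber x) : 𝒢.ReducedCStar →L[ℂ] ℂ :=
  LinearMap.mkContinuous
    { toFun := fun a => a.1.op x (lp.single 2 k 1) g
      map_add' := fun a b => rfl
      map_smul' := fun c a => rfl } 1
    (fun a => by rw [one_mul]; exact 𝒢.norm_op_single_le a x k g)

open Classical in
-- The identity holds on C_c(G) and both sides are continuous in a. All matrices of a are therefore
-- governed by the single function `coeff a` on G.
theorem op_single_apply (a : 𝒢.ReducedCStar) (x : X) (k g : 𝒢.SrcFiber x) :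
    a.1.op x (lp.single 2 k 1) g = 𝒢.coeff a (𝒢.rdiv g k (g.2.trans k.2.symm)) := by
  refine 𝒢.eq_of_eq_ofCc (φ := 𝒢.entryL x k g)
    (χ := 𝒢.coeffL (𝒢.rdiv g k (g.2.trans k.2.symm))) (map_continuous _) (map_continuous _) ?_ a
  intro f
  rw [coeffL_apply, coeff_ofCc]
  exact 𝒢.regRep_single x f g k

/-- An element of the reduced `C*`-algebra is determined by its coefficients. -/
theorem ext_coeff {a b : 𝒢.ReducedCStar} (h : ∀ g, 𝒢.coeff a g = 𝒢.coeff b g) : a = b := by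
  classical
  refine Subtype.ext (BddFamilies.ext fun x => 𝒢.hilb_ext fun k g => ?_)
  rw [op_single_apply, op_single_apply, h]

theorem conv_apply (f₁ f₂ : C_c(G, ℂ)) (g : G) : 𝒢.conv f₁ f₂ g =
    ∑' h : 𝒢.RngFiber (𝒢.rng g), f₁ h * f₂ (𝒢.ldiv h g h.2) := rfl

/-- If `f₁` is supported where the range map is injective, convolution has a single term. -/
theorem conv_mul_apply {f₁ : C_c(G, ℂ)} {V : Set G} (hV : InjOn 𝒢.rng V)
    (hf : ∀ g, f₁ g ≠ 0 → g ∈ V) (f₂ : C_c(G, ℂ)) (h k : G) (hk : 𝒢.src h = 𝒢.rng k)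
    (hh : h ∈ V) : 𝒢.conv f₁ f₂ (𝒢.mul h k hk) = f₁ h * f₂ k := by
  rw [conv_apply, tsum_eq_single ⟨h, (𝒢.rng_mul h k hk).symm⟩]
  · simp only [𝒢.ldiv_mul]
  · intro h' hne
    have : f₁ h' = 0 := by
      by_contra h0
      exact hne (Subtype.ext (hV (hf _ h0) hh (h'.2.trans (𝒢.rng_mul h k hk))))
    rw [this, zero_mul]

/-- Multiplication by a function supported on the units, from the left. -/
theorem coeff_mul_left {d : C_c(G, ℂ)} (hd : ∀ g, d g ≠ 0 → g ∈ 𝒢.unitSet) (a : 𝒢.ReducedCStar)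
    (g : G) : 𝒢.coeff (𝒢.ofCc d * a) g = d (𝒢.unit (𝒢.rng g)) * 𝒢.coeff a g := by
  refine 𝒢.eq_of_eq_ofCc (φ := fun a => 𝒢.coeffL g (𝒢.ofCc d * a))
    (χ := fun a => d (𝒢.unit (𝒢.rng g)) * 𝒢.coeffL g a) (by fun_prop) (by fun_prop) ?_ a
  intro f
  simp only [coeffL_apply]
  rw [← ofCc_conv, coeff_ofCc, coeff_ofCc]
  have hV : InjOn 𝒢.rng 𝒢.unitSet := fun g hg h hh e => by
    rw [show g = _ from hg, show h = _ from hh, e]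
  have h1 := 𝒢.conv_mul_apply hV hd f (𝒢.unit (𝒢.rng g)) g (𝒢.src_unit _) (𝒢.unit_mem_unitSet _)
  rwa [𝒢.unit_mul] at h1

/-- Multiplication by a function supported on the units, from the right. -/
theorem coeff_mul_right {d : C_c(G, ℂ)} (hd : ∀ g, d g ≠ 0 → g ∈ 𝒢.unitSet) (a : 𝒢.ReducedCStar)
    (g : G) : 𝒢.coeff (a * 𝒢.ofCc d) g = 𝒢.coeff a g * d (𝒢.unit (𝒢.src g)) := by
  refine 𝒢.eq_of_eq_ofCc (φ := fun a => 𝒢.coeffL g (a * 𝒢.ofCc d))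
    (χ := fun a => 𝒢.coeffL g a * d (𝒢.unit (𝒢.src g))) (by fun_prop) (by fun_prop) ?_ a
  intro f
  simp only [coeffL_apply]
  rw [← ofCc_conv, coeff_ofCc, coeff_ofCc, conv_apply, tsum_eq_single ⟨g, rfl⟩]
  · congr 2
    exact 𝒢.inv_mul g
  · intro h hne
    have : d (𝒢.ldiv h g h.2) = 0 := by
      by_contra h0
      have h1 : _ = _ := hd _ h0
      rw [𝒢.rng_ldiv] at h1
      have h2 := 𝒢.mul_ldiv h g h.2
      rw [𝒢.mul_congr _ rfl h1, 𝒢.mul_unit'] at h2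
      exact hne (Subtype.ext h2)
    rw [this, mul_zero]

/-- The norm of a function supported on a bisection is at most its supremum norm. -/
theorem norm_ofCc_le {f : C_c(G, ℂ)} {V : Set G} (hr : InjOn 𝒢.rng V) (hs : InjOn 𝒢.src V)
    (hf : ∀ g, f g ≠ 0 → g ∈ V) {C : ℝ} (hC : 0 ≤ C) (hfC : ∀ g, ‖f g‖ ≤ C) :
    ‖𝒢.ofCc f‖ ≤ C := by
  classical
  -- On a bisection each row and each column of the matrix has at most one non-zero entry, so C
  -- serves as the bound in the Schur test.
  have sum_le : ∀ {ι : Type u} (φ : ι → G), (∀ i j, f (φ i) ≠ 0 → f (φ j) ≠ 0 → i = j) →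
      ∀ s : Finset ι, ∑ i ∈ s, ‖f (φ i)‖ ≤ C := by
    intro ι φ hφ s
    by_cases h : ∃ i ∈ s, f (φ i) ≠ 0
    · obtain ⟨i, hi, hi'⟩ := h
      rw [Finset.sum_eq_single_of_mem i hi]
      · exact hfC _
      · intro j _ hj
        by_contra h0
        exact hj (hφ j i (norm_ne_zero_iff.1 h0) hi')
    · push Not at h
      rw [Finset.sum_eq_zero fun i hi => by rw [h i hi, norm_zero]]
      exact hC
  rw [norm_ofCc]
  refine Real.iSup_le (fun x => ContinuousLinearMap.opNorm_le_bound _ hC fun ψ => ?_) hC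
  refine lp.norm_le_of_forall_sum_le (p := 2) (by simp) (by positivity) fun s => ?_
  have h1 := (schur_sum_bound (fun g k : 𝒢.SrcFiber x => f (𝒢.rdiv g k (g.2.trans k.2.symm))) C
    (fun g => sum_le _ fun k k' hk hk' => ?_) (fun k => sum_le _ fun g g' hg hg' => ?_) ψ).2 s
  · simpa [regRep_apply, tsum_fiber_eq] using h1
  · have e := hr (hf _ hk) (hf _ hk') (by rw [𝒢.rng_rdiv, 𝒢.rng_rdiv])
    have e1 := 𝒢.ldiv_rdiv g k (g.2.trans k.2.symm)
    have e2 := 𝒢.ldiv_rdiv g k' (g.2.trans k'.2.symm)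
    simp only [e] at e1
    exact Subtype.ext (e1.symm.trans e2)
  · have e := hs (hf _ hg) (hf _ hg') (by rw [𝒢.src_rdiv, 𝒢.src_rdiv])
    have e1 := 𝒢.rdiv_mul g k (g.2.trans k.2.symm)
    have e2 := 𝒢.rdiv_mul g' k (g'.2.trans k.2.symm)
    simp only [e] at e1
    exact Subtype.ext (e1.symm.trans e2)

end EtaleGroupoid

/-! ### Linear extension of a proper weight -/

namespace CStarWeight

variable {A : Type*} [NonUnitalCStarAlgebra A] [PartialOrder A] [StarOrderedRing A]
  {ψ : CStarWeight A}

theorem IsProper.linExt_sub (h : ψ.IsProper) {a b : A} (ha : a ∈ ψ.domain) (hb : b ∈ ψ.domain) :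
    ψ.linExt (a - b) = ψ.linExt a - ψ.linExt b := by
  obtain ⟨L, hL⟩ := h.exists_isExtension
  have h1 := L.map_sub ⟨a, ha⟩ ⟨b, hb⟩
  rwa [← linExt_eq h hL, ← linExt_eq h hL, ← linExt_eq h hL] at h1

theorem IsProper.linExt_of_nonneg (h : ψ.IsProper) {a : A} (ha : a ∈ ψ.domain) (h0 : 0 ≤ a) :
    ψ.toFun ⟨a, h0⟩ < ∞ ∧ ψ.linExt a = ((ψ.toFun ⟨a, h0⟩).toReal : ℂ) := by
  obtain ⟨L, hL⟩ := h.exists_isExtension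
  have h1 := hL ⟨a, ha⟩ h0
  rwa [← linExt_eq h hL] at h1

theorem IsProper.toFun_eq_zero (h : ψ.IsProper) {a : A} (ha : a ∈ ψ.domain) (h0 : 0 ≤ a)
    (hz : ψ.linExt a = 0) : ψ.toFun ⟨a, h0⟩ = 0 := by
  obtain ⟨h1, h2⟩ := h.linExt_of_nonneg ha h0
  rw [hz] at h2
  -- `toReal` also vanishes at infinity, hence the appeal to finiteness.
  exact (ENNReal.toReal_eq_zero_iff _).1 (by exact_mod_cast h2.symm) |>.resolve_right h1.ne

end CStarWeight

/-- The structure does not demand that `aut 0` be the identity. It is idempotent by the group law,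
and injective. -/
theorem OneParameterGroup.aut_zero {A : Type*} [NonUnitalCStarAlgebra A] (α : OneParameterGroup A)
    (a : A) : α.aut 0 a = a :=
  by
  have h : α.aut 0 (α.aut 0 a) = α.aut 0 a := by rw [← α.aut_add, add_zero]
  exact (α.aut 0).injective h

/-! ### Diagonal KMS weights: full support and invariance of functions on the units -/

namespace EtaleGroupoid

open Set Filter Topology MeasureTheory

variable {G : Type u} {X : Type v} [TopologicalSpace G] [TopologicalSpace X]
  (𝒢 : EtaleGroupoid G X)

theorem lintegral_unit_lt_top [T2Space G] [MeasurableSpace X] [BorelSpace X]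
    (m : Measure X) [IsFiniteMeasureOnCompacts m] (f : C_c(G, ℂ)) :
    ∫⁻ x, ENNReal.ofReal (f (𝒢.unit x)).re ∂m < ∞ := by
  have := 𝒢.t2Space_units
  have hK : IsCompact (𝒢.rng '' tsupport f) :=
    f.hasCompactSupport.isCompact.image 𝒢.continuous_rng
  obtain ⟨B, hB⟩ : ∃ B, ∀ g, ‖f g‖ ≤ B :=
    f.hasCompactSupport.exists_bound_of_continuous f.continuous
  calc ∫⁻ x, ENNReal.ofReal (f (𝒢.unit x)).re ∂m
      ≤ ∫⁻ x, (𝒢.rng '' tsupport f).indicator (fun _ => ENNReal.ofReal B) x ∂m := by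
        refine lintegral_mono fun x => ?_
        by_cases hx : x ∈ 𝒢.rng '' tsupport f
        · rw [indicator_of_mem hx]
          exact ENNReal.ofReal_le_ofReal ((Complex.re_le_norm _).trans (hB _))
        · have h0 : f (𝒢.unit x) = 0 := by
            by_contra h0
            exact hx ⟨𝒢.unit x, subset_tsupport _ h0, 𝒢.rng_unit x⟩
          simp [h0]
    _ = ENNReal.ofReal B * m (𝒢.rng '' tsupport f) :=
        lintegral_indicator_const hK.isClosed.measurableSet _
    _ < ∞ := ENNReal.mul_lt_top ENNReal.ofReal_lt_top hK.measure_lt_top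

variable [T2Space G] [LocallyCompactSpace G]

open Classical in
/-- The image of the point mass at the unit `x` under `a`. -/
noncomputable def vec (a : 𝒢.ReducedCStar) (x : X) : 𝒢.Hilb x :=
  a.1.op x (lp.single 2 (⟨𝒢.unit x, 𝒢.src_unit x⟩ : 𝒢.SrcFiber x) 1)

theorem vec_apply (a : 𝒢.ReducedCStar) (x : X) (g : 𝒢.SrcFiber x) :
    𝒢.vec a x g = 𝒢.coeff a g := by
  rw [vec, op_single_apply]
  congr 1
  have h1 := 𝒢.mul_rdiv g (𝒢.unit x) (g.2.trans (𝒢.rng_unit x).symm)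
  simpa only [𝒢.mul_unit'] using h1

theorem vec_eq_zero_iff (a : 𝒢.ReducedCStar) (x : X) :
    𝒢.vec a x = 0 ↔ ∀ g, 𝒢.src g = x → 𝒢.coeff a g = 0 := by
  constructor
  · intro h g hg
    rw [← 𝒢.vec_apply a x ⟨g, hg⟩, h]
    rfl
  · intro h
    ext g
    rw [vec_apply, h g g.2]
    rfl

/-- P(a) at x is the diagonal matrix entry at the point mass of the unit. In particular P(a*a)(x) is
a squared norm, so null sets for ψ can be read off from `vec`. -/
theorem expect_star_mul (a b : 𝒢.ReducedCStar) (x : X) :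
    𝒢.expect (star a * b) x = inner ℂ (𝒢.vec a x) (𝒢.vec b x) := by
  classical
  set δ : 𝒢.Hilb x := lp.single 2 (⟨𝒢.unit x, 𝒢.src_unit x⟩ : 𝒢.SrcFiber x) 1 with hδ
  have h1 : ∀ (φ : 𝒢.Hilb x), φ ⟨𝒢.unit x, 𝒢.src_unit x⟩ = inner ℂ δ φ := by
    intro φ; rw [hδ, lp.inner_single_left]; simp
  have h2 : 𝒢.expect (star a * b) x =
      (star (a.1.op x) * b.1.op x) δ ⟨𝒢.unit x, 𝒢.src_unit x⟩ := by
    rw [hδ]; rfl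
  rw [h2, h1, mul_apply_eq_comp, ContinuousLinearMap.star_eq_adjoint,
    ContinuousLinearMap.adjoint_inner_right]
  rfl

theorem re_expect_star_mul_self (a : 𝒢.ReducedCStar) (x : X) :
    (𝒢.expect (star a * a) x).re = ‖𝒢.vec a x‖ ^ 2 := by
  rw [expect_star_mul, inner_self_eq_norm_sq_to_K]
  norm_cast

theorem isOpen_vec_ne_zero (a : 𝒢.ReducedCStar) : IsOpen {x | 𝒢.vec a x ≠ 0} := by
  have h1 : {x | 𝒢.vec a x ≠ 0} = {x | (𝒢.expect (star a * a) x).re ≠ 0} := by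
    ext x
    simp [re_expect_star_mul_self]
  rw [h1]
  exact isOpen_ne_fun (Complex.continuous_re.comp (map_continuous _)) continuous_const

/-- At a unit both sides are the coefficient of a times the value of d. This places functions on the
units in the centralizer of a diagonal weight. -/
theorem expect_mul_comm {d : C_c(G, ℂ)} (hd : ∀ g, d g ≠ 0 → g ∈ 𝒢.unitSet)
    (a : 𝒢.ReducedCStar) : 𝒢.expect (𝒢.ofCc d * a) = 𝒢.expect (a * 𝒢.ofCc d) := by
  ext x
  rw [← coeff_eq_expect, ← coeff_eq_expect, 𝒢.coeff_mul_left hd, 𝒢.coeff_mul_right hd, 𝒢.rng_unit,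
    𝒢.src_unit, mul_comm]

variable [MeasurableSpace X] [BorelSpace X]

/-- The weight given by integration of the conditional expectation against the measure `m`. -/
def IsWeightOf (ψ : CStarWeight 𝒢.ReducedCStar) (m : Measure X) : Prop :=
  ∀ a, ψ.toFun a = ∫⁻ x, ENNReal.ofReal (𝒢.expect a x).re ∂m

variable {𝒢} {ψ : CStarWeight 𝒢.ReducedCStar} {m : Measure X}

/-- The product f* f is again in C_c(G), and m is finite on compact sets. Thus the KMS condition
applies to all of C_c(G). -/
theorem IsWeightOf.ofCc_mem_sqFinite (hm : 𝒢.IsWeightOf ψ m) [IsFiniteMeasureOnCompacts m]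
    (f : C_c(G, ℂ)) : 𝒢.ofCc f ∈ ψ.sqFinite := by
  have h1 : star (𝒢.ofCc f) * 𝒢.ofCc f = 𝒢.ofCc (𝒢.conv (𝒢.involution f) f) := by
    rw [ofCc_conv, ofCc_involution]
  change ψ.toFun _ < ∞
  rw [hm]
  simp only [h1, expect_ofCc]
  exact 𝒢.lintegral_unit_lt_top m _

theorem IsWeightOf.star_ofCc_mem_sqFinite (hm : 𝒢.IsWeightOf ψ m) [IsFiniteMeasureOnCompacts m]
    (f : C_c(G, ℂ)) : star (𝒢.ofCc f) ∈ ψ.sqFinite := by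
  rw [← ofCc_involution]
  exact hm.ofCc_mem_sqFinite _

theorem measurable_expect (a : 𝒢.ReducedCStar) : Measurable (𝒢.expect a) :=
  (map_continuous (𝒢.expect a)).measurable

theorem measurable_re_expect (a : 𝒢.ReducedCStar) : Measurable fun x => (𝒢.expect a x).re :=
  Complex.measurable_re.comp (measurable_expect a)

theorem IsWeightOf.integrable_of_finPos (hm : 𝒢.IsWeightOf ψ m) {a : 𝒢.ReducedCStar}
    (ha : ψ.FinPos a) : Integrable (𝒢.expect a) m := by
  obtain ⟨h0, h1⟩ := ha
  refine ⟨(measurable_expect a).aestronglyMeasurable, ?_⟩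
  rw [hm] at h1
  refine lt_of_le_of_lt (lintegral_mono fun x => ?_) h1
  obtain ⟨v, hv, e⟩ := 𝒢.expect_nonneg h0 x
  rw [e, Complex.ofReal_re, ← ofReal_norm, Complex.norm_real, Real.norm_of_nonneg hv]

theorem IsWeightOf.integrable (hm : 𝒢.IsWeightOf ψ m) (h : ψ.IsProper) {a : 𝒢.ReducedCStar}
    (ha : a ∈ ψ.domain) : Integrable (𝒢.expect a) m := by
  obtain ⟨⟨_, p, q, hp, hq, e, -⟩, _, p', q', hp', hq', e', -⟩ :=
    CStarWeight.finDiff_of_mem_domain h ha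
  rw [← realPart_add_I_smul_imaginaryPart a, e, e']
  have h1 : 𝒢.expect (p - q + Complex.I • (p' - q')) =
      𝒢.expect p - 𝒢.expect q + Complex.I • (𝒢.expect p' - 𝒢.expect q') := by
    rw [map_add, map_smul, map_sub, map_sub]
  rw [h1]
  exact ((hm.integrable_of_finPos hp).sub (hm.integrable_of_finPos hq)).add
    (((hm.integrable_of_finPos hp').sub (hm.integrable_of_finPos hq')).smul Complex.I)

/-- Integration of P against m is a linear extension of ψ, and such extensions are unique. -/
theorem IsWeightOf.linExt_eq (hm : 𝒢.IsWeightOf ψ m) (h : ψ.IsProper) {a : 𝒢.ReducedCStar}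
    (ha : a ∈ ψ.domain) : ψ.linExt a = ∫ x, 𝒢.expect a x ∂m := by
  let L : ψ.domain →ₗ[ℂ] ℂ :=
    { toFun := fun a => ∫ x, 𝒢.expect a x ∂m
      map_add' := fun a b => by
        rw [← integral_add (hm.integrable h a.2) (hm.integrable h b.2), Submodule.coe_add, map_add]
        rfl
      map_smul' := fun c a => by
        rw [RingHom.id_apply, ← integral_smul, Submodule.coe_smul, map_smul]
        rfl }
  refine CStarWeight.linExt_eq (L := L) h (fun b hb => ?_) ⟨a, ha⟩
  have hfin := (h.linExt_of_nonneg b.2 hb).1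
  refine ⟨hfin, ?_⟩
  have h1 : ∀ x, 𝒢.expect b x = ((𝒢.expect b x).re : ℂ) ∧ 0 ≤ (𝒢.expect b x).re := by
    intro x
    obtain ⟨v, hv, e⟩ := 𝒢.expect_nonneg hb x
    simp [e, hv]
  change ∫ x, 𝒢.expect b x ∂m = _
  rw [hm, ← integral_eq_lintegral_of_nonneg_ae (ae_of_all _ fun x => (h1 x).2)
    (measurable_re_expect (b : 𝒢.ReducedCStar)).aestronglyMeasurable,
    ← integral_complex_ofReal]
  exact integral_congr_ae (ae_of_all _ fun x => (h1 x).1)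

theorem IsWeightOf.measure_vec_ne_zero (hm : 𝒢.IsWeightOf ψ m) {a : 𝒢.ReducedCStar}
    (ha : ψ.toFun ⟨star a * a, star_mul_self_nonneg a⟩ = 0) : m {x | 𝒢.vec a x ≠ 0} = 0 := by
  rw [hm, lintegral_eq_zero_iff
    (measurable_re_expect (star a * a)).ennreal_ofReal] at ha
  refine measure_mono_null (fun x hx => ?_) ha
  simp only [re_expect_star_mul_self, mem_compl_iff, mem_ofPred_eq] at hx ⊢
  simpa using hx

variable {α : OneParameterGroup 𝒢.ReducedCStar} {β : ℝ}

/-- Minimality gives an arrow g from U to y. For a bump f at g supported on arrows starting in U,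
P(f* α_t(f)) vanishes off the null set U, so the KMS function is zero on the real line and hence on
the other edge. There it gives ψ(f f*) = 0 at t = 0. So the open set where `vec` of f* is non-zero
is null, and it contains y because f* equals 1 at g⁻¹. -/
theorem exists_measure_nhds_eq_zero (hβ : β ≠ 0) (hψ : IsKMSWeight ψ α β)
    (hm : 𝒢.IsWeightOf ψ m) [IsFiniteMeasureOnCompacts m] (hmin : 𝒢.IsMinimal) {U : Set X}
    (hU : IsOpen U) (hne : U.Nonempty) (h0 : m U = 0) (y : X) : ∃ W ∈ 𝓝 y, m W = 0 := by
  obtain ⟨_, hgU, g, hgy, rfl⟩ := (hmin y).inter_open_nonempty U hU hne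
  change 𝒢.rng g = y at hgy
  obtain ⟨f, hf1, -, hfU⟩ := exists_bump g (hU.preimage 𝒢.continuous_src) hgU
  have hs := hm.ofCc_mem_sqFinite f
  have hs' := hm.star_ofCc_mem_sqFinite f
  have hs'' : star (star (𝒢.ofCc f)) ∈ ψ.sqFinite := by rwa [star_star]
  obtain ⟨F, hc, hb, hd, hF⟩ := hψ.kms _ _ hs' hs'' hs hs'
  have hzero : ∀ t : ℝ, F t = 0 := by
    intro t
    rw [(hF t).1, hm.linExt_eq hψ.proper (hψ.mul_mem_domain hs' hs'' hs hs' t).1]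
    refine integral_eq_zero_of_ae ?_
    refine measure_mono_null (fun x hx => ?_) h0
    by_contra hxU
    refine hx ?_
    change 𝒢.expect _ x = 0
    rw [expect_star_mul, (𝒢.vec_eq_zero_iff _ x).2, inner_zero_left]
    intro k hk
    rw [coeff_ofCc]
    by_contra hk'
    exact hxU (hk ▸ hfU k hk')
  have h1 := eq_zero_of_boundary_eq_zero hβ hc hb hd hzero 0
  rw [(hF 0).2] at h1
  have hdom := (hψ.mul_mem_domain hs' hs'' hs hs' 0).2
  rw [α.aut_zero] at h1 hdom
  have h2 := hψ.proper.toFun_eq_zero hdom (mul_star_self_nonneg _) h1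
  have h3 := hm.measure_vec_ne_zero (a := star (𝒢.ofCc f)) (by simpa only [star_star] using h2)
  refine ⟨_, (𝒢.isOpen_vec_ne_zero (star (𝒢.ofCc f))).mem_nhds ?_, h3⟩
  intro h4
  rw [vec_eq_zero_iff] at h4
  have h5 := h4 (𝒢.inv g) ((𝒢.src_inv g).trans hgy)
  rw [← ofCc_involution, coeff_ofCc, involution_apply, 𝒢.inv_inv, hf1, map_one] at h5
  exact one_ne_zero h5

/-- The measure of a diagonal KMS weight on a minimal groupoid has full support. -/
theorem isOpenPosMeasure_of_isKMSWeight (hβ : β ≠ 0) (hψ : IsKMSWeight ψ α β)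
    (hm : 𝒢.IsWeightOf ψ m) [IsFiniteMeasureOnCompacts m] (hmin : 𝒢.IsMinimal) :
    m.IsOpenPosMeasure := by
  refine ⟨fun U hU hne h0 => ?_⟩
  have hK : ∀ K : Set X, IsCompact K → m K = 0 := fun K hK =>
    hK.measure_zero_of_nhdsWithin fun y _ => by
      obtain ⟨W, hW, hW0⟩ := exists_measure_nhds_eq_zero hβ hψ hm hmin hU hne h0 y
      exact ⟨W, mem_nhdsWithin_of_mem_nhds hW, hW0⟩
  obtain ⟨a, ha⟩ := hψ.proper.ne_zero
  refine ha ?_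
  rw [hm, lintegral_eq_zero_iff
    (measurable_re_expect (a : 𝒢.ReducedCStar)).ennreal_ofReal]
  -- Only compact sets are known to be null. As P(a) vanishes at infinity, the set where it is
  -- non-zero is a countable union of sets that lie in compact ones.
  have h1 : m (⋃ n : ℕ, {x | ¬ ‖𝒢.expect a x‖ < 1 / (n + 1 : ℝ)}) = 0 := by
    refine measure_iUnion_null fun n => ?_
    have h2 := (𝒢.tendsto_expectFun (a : 𝒢.ReducedCStar)).norm
    rw [norm_zero] at h2
    have h3 := h2.eventually (gt_mem_nhds (show (0 : ℝ) < 1 / (n + 1) by positivity))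
    obtain ⟨K, hKc, hKs⟩ := mem_cocompact'.1 h3
    exact measure_mono_null hKs (hK K hKc)
  refine measure_mono_null (fun x hx => ?_) h1
  have h2 : 𝒢.expect a x ≠ 0 := fun h => hx (by simp [h])
  obtain ⟨n, hn⟩ := exists_nat_one_div_lt (norm_pos_iff.2 h2)
  exact mem_iUnion.2 ⟨n, not_lt.2 hn.le⟩

/-- Faithfulness of ψ: the set where `vec a` is non-zero is open and null, hence empty. -/
theorem IsWeightOf.eq_zero_of_toFun_eq_zero [m.IsOpenPosMeasure] (hm : 𝒢.IsWeightOf ψ m)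
    {a : 𝒢.ReducedCStar} (ha : ψ.toFun ⟨star a * a, star_mul_self_nonneg a⟩ = 0) : a = 0 := by
  have h1 := (𝒢.isOpen_vec_ne_zero a).eq_empty_of_measure_zero (hm.measure_vec_ne_zero ha)
  refine 𝒢.ext_coeff fun g => ?_
  have h2 : 𝒢.vec a (𝒢.src g) = 0 := by
    by_contra h
    have : 𝒢.src g ∈ ({x | 𝒢.vec a x ≠ 0} : Set X) := h
    rw [h1] at this
    exact this
  exact (𝒢.vec_eq_zero_iff a _).1 h2 g rfl

/-- The first equality is `expect_mul_comm`. It says that the KMS function of d and e agrees on the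
two edges of the strip, so this function is constant, which is the second equality. -/
theorem linExt_mul_aut (hβ : β ≠ 0) (hψ : IsKMSWeight ψ α β) (hm : 𝒢.IsWeightOf ψ m)
    [IsFiniteMeasureOnCompacts m] {d e : C_c(G, ℂ)} (hd : ∀ g, d g ≠ 0 → g ∈ 𝒢.unitSet) (t : ℝ) :
    ψ.linExt (α.aut t (𝒢.ofCc e) * 𝒢.ofCc d) = ψ.linExt (𝒢.ofCc d * α.aut t (𝒢.ofCc e)) ∧
      ψ.linExt (𝒢.ofCc d * α.aut t (𝒢.ofCc e)) = ψ.linExt (𝒢.ofCc d * 𝒢.ofCc e) := by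
  have h1 := hm.ofCc_mem_sqFinite d
  have h2 := hm.star_ofCc_mem_sqFinite d
  have h3 := hm.ofCc_mem_sqFinite e
  have h4 := hm.star_ofCc_mem_sqFinite e
  have hcomm : ∀ t : ℝ, ψ.linExt (α.aut t (𝒢.ofCc e) * 𝒢.ofCc d) =
      ψ.linExt (𝒢.ofCc d * α.aut t (𝒢.ofCc e)) := by
    intro t
    obtain ⟨h5, h6⟩ := hψ.mul_mem_domain h1 h2 h3 h4 t
    rw [hm.linExt_eq hψ.proper h5, hm.linExt_eq hψ.proper h6, 𝒢.expect_mul_comm hd]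
  refine ⟨hcomm t, ?_⟩
  obtain ⟨F, hc, hb, hdiff, hF⟩ := hψ.kms _ _ h1 h2 h3 h4
  have h5 := eq_const_of_boundary_periodic hβ hc hb hdiff
    (fun t => by rw [(hF t).1, (hF t).2, hcomm]) t
  have h6 := (hF 0).1
  rw [Complex.ofReal_zero, α.aut_zero] at h6
  rw [← (hF t).1, h5, h6]

/-- A one-parameter group with a diagonal KMS weight fixes the functions on the unit space. -/
theorem aut_ofCc_unit (hβ : β ≠ 0) (hψ : IsKMSWeight ψ α β) (hm : 𝒢.IsWeightOf ψ m)
    [IsFiniteMeasureOnCompacts m] [m.IsOpenPosMeasure] {d : C_c(G, ℂ)}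
    (hd : ∀ g, d g ≠ 0 → g ∈ 𝒢.unitSet) (t : ℝ) : α.aut t (𝒢.ofCc d) = 𝒢.ofCc d := by
  set e := 𝒢.involution d with he
  have hed : 𝒢.ofCc e = star (𝒢.ofCc d) := 𝒢.ofCc_involution d
  have hsupp := 𝒢.involution_supported_unitSet hd
  have h1 := hm.ofCc_mem_sqFinite d
  have h2 := hm.star_ofCc_mem_sqFinite d
  have h1' := hm.ofCc_mem_sqFinite e
  have h2' := hm.star_ofCc_mem_sqFinite e
  obtain ⟨p1, p2⟩ := hψ.mul_mem_domain h1 h2 h1' h2' t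
  obtain ⟨p3, p4⟩ := hψ.mul_mem_domain h1' h2' h1 h2 t
  obtain ⟨p5, p6⟩ := hψ.mul_mem_domain h1' h2' h1 h2 0
  rw [α.aut_zero] at p5 p6
  obtain ⟨c1, c2⟩ := linExt_mul_aut (e := e) hβ hψ hm hd t
  obtain ⟨c3, c4⟩ := linExt_mul_aut (e := d) hβ hψ hm hsupp t
  have c5 := (linExt_mul_aut (e := d) hβ hψ hm hsupp 0).1
  rw [α.aut_zero] at c5
  have hnn : 0 ≤ 𝒢.ofCc e * 𝒢.ofCc d := by rw [hed]; exact star_mul_self_nonneg _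
  have hnn' : 0 ≤ α.aut t (𝒢.ofCc e) * α.aut t (𝒢.ofCc d) := by
    rw [hed, map_star]; exact star_mul_self_nonneg _
  have hinv : ψ.toFun ⟨_, hnn'⟩ = ψ.toFun ⟨_, hnn⟩ := by
    rw [← hψ.invariant t ⟨_, hnn⟩]
    simp only [map_mul]
  have p7 : α.aut t (𝒢.ofCc e) * α.aut t (𝒢.ofCc d) ∈ ψ.domain := by
    refine CStarWeight.FinPos.mem_domain ⟨hnn', ?_⟩
    rw [hinv]
    exact (hψ.proper.linExt_of_nonneg p5 hnn).1
  have c6 : ψ.linExt (α.aut t (𝒢.ofCc e) * α.aut t (𝒢.ofCc d)) =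
      ψ.linExt (𝒢.ofCc e * 𝒢.ofCc d) := by
    rw [(hψ.proper.linExt_of_nonneg p7 hnn').2, (hψ.proper.linExt_of_nonneg p5 hnn).2, hinv]
  -- Each of the four terms has the value ψ(d*d): the first by invariance of ψ, the mixed ones by
  -- `linExt_mul_aut` applied to d and to its adjoint e.
  have hexp : star (α.aut t (𝒢.ofCc d) - 𝒢.ofCc d) * (α.aut t (𝒢.ofCc d) - 𝒢.ofCc d) =
      (α.aut t (𝒢.ofCc e) * α.aut t (𝒢.ofCc d) - α.aut t (𝒢.ofCc e) * 𝒢.ofCc d) -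
        (𝒢.ofCc e * α.aut t (𝒢.ofCc d) - 𝒢.ofCc e * 𝒢.ofCc d) := by
    rw [star_sub, ← map_star, ← hed, sub_mul, mul_sub, mul_sub]
  have q1 := ψ.domain.sub_mem p7 p2
  have q2 := ψ.domain.sub_mem p3 p5
  have hz : ψ.linExt (star (α.aut t (𝒢.ofCc d) - 𝒢.ofCc d) *
      (α.aut t (𝒢.ofCc d) - 𝒢.ofCc d)) = 0 := by
    rw [hexp, hψ.proper.linExt_sub q1 q2, hψ.proper.linExt_sub p7 p2,
      hψ.proper.linExt_sub p3 p5, c6, c1, c2, c4, c5]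
    ring
  refine sub_eq_zero.1 (hm.eq_zero_of_toFun_eq_zero (hψ.proper.toFun_eq_zero ?_ _ hz))
  rw [hexp]
  exact ψ.domain.sub_mem q1 q2

end EtaleGroupoid

/-! ### One-parameter groups of complex numbers -/

section OneParameter

open Complex

/-- A continuous one-parameter group of non-zero complex numbers has a non-zero local average. -/
theorem exists_integral_ne_zero {u : ℝ → ℂ} (hu : Continuous u) (h0 : u 0 = 1) :
    ∃ δ : ℝ, ∫ s in (0 : ℝ)..δ, u s ≠ 0 := by
  by_contra! h
  have h1 : HasDerivAt (fun x => ∫ s in (0 : ℝ)..x, u s) (u 0) 0 := hu.integral_hasStrictDerivAt 0 0 |>.hasDerivAt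
  simp only [h] at h1
  have h2 := h1.unique (hasDerivAt_const 0 0)
  rw [h0] at h2
  exact one_ne_zero h2

/-- A bounded continuous one-parameter group of complex numbers is a character. -/
theorem exists_eq_exp_of_continuous_add_eq_mul {u : ℝ → ℂ} (hu : Continuous u) (h0 : u 0 = 1)
    (hadd : ∀ s t, u (s + t) = u s * u t) {C : ℝ} (hC : ∀ t, ‖u t‖ ≤ C) :
    ∃ c : ℝ, ∀ t : ℝ, u t = exp (I * t * c) := by
  obtain ⟨δ, hδ⟩ := exists_integral_ne_zero hu h0
  set w := ∫ s in (0 : ℝ)..δ, u s with hw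
  set W : ℝ → ℂ := fun x => ∫ s in (0 : ℝ)..x, u s with hW
  have hWd : ∀ x, HasDerivAt W (u x) x := fun x => (hu.integral_hasStrictDerivAt 0 x).hasDerivAt
  -- Multiplying the average w by u t shifts the interval of integration. This writes u through a
  -- primitive, so u is differentiable, with u' = zu for z = (u δ - 1) / w.
  have h1 : ∀ t, u t = (W (t + δ) - W t) / w := by
    intro t
    rw [eq_div_iff hδ, hw, ← intervalIntegral.integral_const_mul]
    simp only [← hadd]
    rw [intervalIntegral.integral_comp_add_left (fun s => u s), add_zero, hW]
    exact (intervalIntegral.integral_interval_sub_left (hu.intervalIntegrable _ _)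
      (hu.intervalIntegrable _ _)).symm
  set z := (u δ - 1) / w with hz
  have hud : ∀ t, HasDerivAt u (z * u t) t := by
    intro t
    have h2 : HasDerivAt (fun t => (W (t + δ) - W t) / w) ((u (t + δ) - u t) / w) t :=
      (((hWd (t + δ)).comp_add_const t δ).sub (hWd t)).div_const w
    rw [← funext h1] at h2
    convert h2 using 1
    rw [hadd, hz]
    ring
  have hexp : ∀ t : ℝ, u t = exp (z * t) := by
    have hd : ∀ t : ℝ, HasDerivAt (fun t : ℝ => u t * exp (-(z * t))) 0 t := by
      intro t
      have h2 : HasDerivAt (fun t : ℝ => exp (-(z * t))) (exp (-(z * t)) * -(z * 1)) t :=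
        (((hasDerivAt_id t).ofReal_comp.const_mul z).neg).cexp
      exact ((hud t).mul h2).congr_deriv (by ring)
    intro t
    have h3 := is_const_of_deriv_eq_zero (fun t => (hd t).differentiableAt)
      (fun t => (hd t).deriv) t 0
    simp only [h0, ofReal_zero, mul_zero, neg_zero, exp_zero, mul_one] at h3
    rw [exp_neg] at h3
    exact (mul_inv_eq_one₀ (exp_ne_zero _)).1 h3
  have hre : z.re = 0 := by
    by_contra hne
    -- At this time the modulus of u is exp C, which exceeds the bound C.
    have h2 := hC (C / z.re)
    rw [hexp, norm_exp] at h2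
    have h3 : (z * (C / z.re : ℝ)).re = C := by
      rw [re_mul_ofReal, mul_div_cancel₀ _ hne]
    rw [h3] at h2
    linarith [Real.add_one_le_exp C]
  refine ⟨z.im, fun t => ?_⟩
  have h2 : z = z.im * I := by
    conv_lhs => rw [← re_add_im z, hre]
    simp
  rw [hexp]
  congr 1
  conv_lhs => rw [h2]
  ring

theorem eq_of_forall_exp_eq {a b : ℝ} (h : ∀ t : ℝ, exp (I * t * a) = exp (I * t * b)) : a = b := by
  by_contra hne
  have h0 : (a : ℂ) - b ≠ 0 := by
    rw [← ofReal_sub]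
    exact ofReal_ne_zero.2 (sub_ne_zero.2 hne)
  -- At this t the quotient of the two exponentials is exp(iπ) = -1.
  have h1 := h (Real.pi / (a - b))
  have h2 : exp (I * (Real.pi / (a - b) : ℝ) * a) / exp (I * (Real.pi / (a - b) : ℝ) * b) = -1 := by
    rw [← exp_sub, ← exp_pi_mul_I]
    congr 1
    push_cast
    field_simp
  rw [h1, div_self (exp_ne_zero _)] at h2
  norm_num at h2

/-- The exponent of a jointly continuous family of characters of `ℝ` is continuous. -/
theorem continuous_exponent {G : Type*} [TopologicalSpace G] {u : ℝ → G → ℂ}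
    (hu : Continuous fun p : ℝ × G => u p.1 p.2) {c : G → ℝ}
    (hc : ∀ t g, u t g = exp (I * t * c g)) : Continuous c := by
  rw [continuous_iff_continuousAt]
  intro g₀
  have hu0 : ∀ g, u 0 g = 1 := fun g => by simp [hc]
  have hug : ∀ g, Continuous fun t => u t g := fun g => hu.comp (by fun_prop : Continuous fun t => (t, g))
  obtain ⟨δ, hδ⟩ := exists_integral_ne_zero (hug g₀) (hu0 g₀)
  have hcont : Continuous fun g => ∫ s in (0 : ℝ)..δ, u s g :=
    intervalIntegral.continuous_parametric_intervalIntegral_of_continuous' (f := fun g s => u s g)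
      (hu.comp continuous_swap) 0 δ
  have hcδ : Continuous fun g => u δ g := hu.comp (by fun_prop : Continuous fun g => (δ, g))
  -- Integrating u' = icu over [0, δ] expresses c(g) by quantities continuous in g, wherever the
  -- average is non-zero; this includes a neighbourhood of g₀.
  have hform : ∀ g, ∫ s in (0 : ℝ)..δ, u s g ≠ 0 →
      ((u δ g - 1) / (I * ∫ s in (0 : ℝ)..δ, u s g)).re = c g := by
    intro g hg
    have h1 : (c g : ℂ) * (I * ∫ s in (0 : ℝ)..δ, u s g) = u δ g - 1 := by
      rw [← mul_assoc, ← intervalIntegral.integral_const_mul, ← hu0 g]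
      refine intervalIntegral.integral_eq_sub_of_hasDerivAt (f := fun s => u s g) (fun s _ => ?_)
        ((continuous_const.mul (hug g)).intervalIntegrable _ _)
      simp only [hc]
      have h2 : HasDerivAt (fun s : ℝ => exp (I * s * c g)) (exp (I * s * c g) * (I * 1 * c g)) s :=
        (((hasDerivAt_id s).ofReal_comp.const_mul I).mul_const _).cexp
      exact h2.congr_deriv (by ring)
    rw [← h1, mul_div_cancel_right₀ _ (mul_ne_zero I_ne_zero hg), ofReal_re]
  have hlim : ContinuousAt (fun g => ((u δ g - 1) / (I * ∫ s in (0 : ℝ)..δ, u s g)).re) g₀ :=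
    continuous_re.continuousAt.comp ((hcδ.sub continuous_const).continuousAt.div
      (continuous_const.mul hcont).continuousAt (mul_ne_zero I_ne_zero hδ))
  refine hlim.congr ?_
  filter_upwards [hcont.continuousAt.eventually_ne hδ] with g hg
  exact hform g hg

end OneParameter

/-! ### One-parameter groups that fix the functions on the units -/

namespace EtaleGroupoid

open Set Filter Topology

variable {G : Type u} {X : Type v} [TopologicalSpace G] [TopologicalSpace X]
  {𝒢 : EtaleGroupoid G X} [T2Space G] [LocallyCompactSpace G]

theorem norm_aut (α : OneParameterGroup 𝒢.ReducedCStar) (t : ℝ) (a : 𝒢.ReducedCStar) :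
    ‖α.aut t a‖ = ‖a‖ :=
  NonUnitalStarAlgHom.norm_map (α.aut t) (α.aut t).injective a

theorem continuous_aut_apply (α : OneParameterGroup 𝒢.ReducedCStar) (t : ℝ) :
    Continuous (α.aut t) :=
  (AddMonoidHomClass.isometry_of_norm (α.aut t) (norm_aut α t)).continuous

variable (𝒢) in
-- The coefficient is continuous in the arrow and 1-Lipschitz in the element, uniformly over arrows.
theorem continuous_coeff_uncurry : Continuous fun p : 𝒢.ReducedCStar × G => 𝒢.coeff p.1 p.2 := by
  refine continuous_prod_of_continuous_lipschitzWith _ 1 𝒢.continuous_coeff fun g => ?_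
  refine LipschitzWith.mk_one fun a b => ?_
  rw [dist_eq_norm, dist_eq_norm, ← coeff_sub]
  exact 𝒢.norm_coeff_le _ g

/-- The one-parameter group fixes the functions supported on the unit space. -/
def FixesUnits (α : OneParameterGroup 𝒢.ReducedCStar) : Prop :=
  ∀ d : C_c(G, ℂ), (∀ g, d g ≠ 0 → g ∈ 𝒢.unitSet) → ∀ t, α.aut t (𝒢.ofCc d) = 𝒢.ofCc d

variable {α : OneParameterGroup 𝒢.ReducedCStar}

/-- Multiply f on both sides by bumps d₁, d₂ on the units, supported near the range and source of g.
As α_t fixes these bumps, the coefficient of α_t(f) at g is unchanged. As g is the only arrow with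
its range and source, the product is supported in a small bisection around g, where f is below ε, so
its norm is at most ε. -/
theorem FixesUnits.coeff_aut_eq_zero (hα : FixesUnits α) {g : G}
    (hg : 𝒢.TrivialIsotropy (𝒢.src g)) {f : C_c(G, ℂ)} (hf : f g = 0) (t : ℝ) :
    𝒢.coeff (α.aut t (𝒢.ofCc f)) g = 0 := by
  have := 𝒢.t2Space_units
  refine norm_le_zero_iff.1 (le_of_forall_pos_le_add fun ε hε => ?_)
  rw [zero_add]
  obtain ⟨V₀, hV₀, hgV₀, hr, hs⟩ := 𝒢.exists_isOpen_bisection g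
  set V := V₀ ∩ {k | ‖f k‖ < ε} with hVdef
  have hV : IsOpen V := hV₀.inter (isOpen_lt f.continuous.norm continuous_const)
  have hgV : g ∈ V := ⟨hgV₀, by simpa [hf] using hε⟩
  -- The part of the support of f outside V has compact image under (range, source), and by trivial
  -- isotropy this image misses the pair of g. An open box around the pair avoids it, and its sides
  -- confine the two bumps.
  have hK : IsCompact ((fun k => (𝒢.rng k, 𝒢.src k)) '' (tsupport f \ V)) :=
    (f.hasCompactSupport.isCompact.diff hV).image (𝒢.continuous_rng.prodMk 𝒢.continuous_src)
  have hgK : (𝒢.rng g, 𝒢.src g) ∈ ((fun k => (𝒢.rng k, 𝒢.src k)) '' (tsupport f \ V))ᶜ := by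
    rintro ⟨k, hk, e⟩
    rw [Prod.mk.injEq] at e
    rw [𝒢.eq_of_trivialIsotropy hg e.1.symm e.2.symm] at hgV
    exact hk.2 hgV
  obtain ⟨W₁, W₂, hW₁, hW₂, hm₁, hm₂, hW⟩ :=
    isOpen_prod_iff.1 hK.isClosed.isOpen_compl _ _ hgK
  have hbump : ∀ x (W : Set X), IsOpen W → x ∈ W → ∃ d : C_c(G, ℂ), d (𝒢.unit x) = 1 ∧
      (∀ k, ‖d k‖ ≤ 1) ∧ ∀ k, d k ≠ 0 → k ∈ 𝒢.unitSet ∩ 𝒢.rng ⁻¹' W := fun x W hW hx =>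
    exists_bump _ (𝒢.isOpen_unitSet.inter (hW.preimage 𝒢.continuous_rng))
      ⟨𝒢.unit_mem_unitSet x, by rwa [mem_preimage, 𝒢.rng_unit]⟩
  obtain ⟨d₁, h₁, hb₁, hs₁⟩ := hbump _ W₁ hW₁ hm₁
  obtain ⟨d₂, h₂, hb₂, hs₂⟩ := hbump _ W₂ hW₂ hm₂
  have hu₁ : ∀ k, d₁ k ≠ 0 → k ∈ 𝒢.unitSet := fun k hk => (hs₁ k hk).1
  have hu₂ : ∀ k, d₂ k ≠ 0 → k ∈ 𝒢.unitSet := fun k hk => (hs₂ k hk).1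
  set h := 𝒢.conv d₁ (𝒢.conv f d₂) with hh
  have hval : ∀ k, h k = d₁ (𝒢.unit (𝒢.rng k)) * (f k * d₂ (𝒢.unit (𝒢.src k))) := by
    intro k
    rw [hh, ← 𝒢.coeff_ofCc, ofCc_conv, 𝒢.coeff_mul_left hu₁, ofCc_conv, 𝒢.coeff_mul_right hu₂,
      coeff_ofCc]
  have hsupp : ∀ k, h k ≠ 0 → k ∈ V := by
    intro k hk
    rw [hval] at hk
    have h3 : 𝒢.rng k ∈ W₁ := by
      have := (hs₁ _ (left_ne_zero_of_mul hk)).2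
      rwa [mem_preimage, 𝒢.rng_unit] at this
    have h4 : 𝒢.src k ∈ W₂ := by
      have := (hs₂ _ (right_ne_zero_of_mul (right_ne_zero_of_mul hk))).2
      rwa [mem_preimage, 𝒢.rng_unit] at this
    by_contra hkV
    exact hW (mk_mem_prod h3 h4)
      ⟨k, ⟨subset_tsupport _ (left_ne_zero_of_mul (right_ne_zero_of_mul hk)), hkV⟩, rfl⟩
  have hnorm : ‖𝒢.ofCc h‖ ≤ ε := by
    refine 𝒢.norm_ofCc_le hr hs (fun k hk => (hsupp k hk).1) hε.le fun k => ?_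
    by_cases hk : h k = 0
    · rw [hk, norm_zero]
      exact hε.le
    · refine le_trans ?_ (hsupp k hk).2.le
      rw [hval, norm_mul, norm_mul]
      calc _ ≤ 1 * (‖f k‖ * 1) := by
            gcongr
            exacts [hb₁ _, hb₂ _]
        _ = ‖f k‖ := by ring
  have hco : 𝒢.coeff (α.aut t (𝒢.ofCc h)) g = 𝒢.coeff (α.aut t (𝒢.ofCc f)) g := by
    rw [hh, ofCc_conv, ofCc_conv, map_mul, map_mul, hα d₁ hu₁, hα d₂ hu₂, 𝒢.coeff_mul_left hu₁,
      𝒢.coeff_mul_right hu₂, h₁, h₂, one_mul, mul_one]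
  rw [← hco]
  refine (𝒢.norm_coeff_le _ g).trans ?_
  rwa [norm_aut]

/-- At an arrow g with trivial isotropy at its source, the combination k(g) f - f(g) k vanishes at
g, so its image under α_t does too. Both sides are continuous in g, so density gives all arrows. -/
theorem FixesUnits.coeff_aut_mul (hα : FixesUnits α)
    (hd : Dense {g | 𝒢.TrivialIsotropy (𝒢.src g)}) (f k : C_c(G, ℂ)) (t : ℝ) (g : G) :
    𝒢.coeff (α.aut t (𝒢.ofCc f)) g * k g = 𝒢.coeff (α.aut t (𝒢.ofCc k)) g * f g := by
  refine congrFun (Continuous.ext_on hd ((𝒢.continuous_coeff _).mul k.continuous)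
    ((𝒢.continuous_coeff _).mul f.continuous) fun g hg => ?_) g
  have h1 := hα.coeff_aut_eq_zero hg (f := k g • f - f g • k)
    (by change k g * f g - f g * k g = 0; ring) t
  rw [map_sub, map_smul, map_smul, map_sub, map_smul, map_smul, coeff_sub, coeff_smul,
    coeff_smul, sub_eq_zero] at h1
  rw [mul_comm (k g), mul_comm (f g)] at h1
  exact h1

/-- The factor by which `α.aut t` multiplies functions at the arrow `g`. -/
noncomputable def factor (α : OneParameterGroup 𝒢.ReducedCStar) (t : ℝ) (g : G) : ℂ :=
  𝒢.coeff (α.aut t (𝒢.ofCc (exists_bump g isOpen_univ (mem_univ g)).choose)) g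

theorem FixesUnits.coeff_aut_ofCc (hα : FixesUnits α)
    (hd : Dense {g | 𝒢.TrivialIsotropy (𝒢.src g)}) (f : C_c(G, ℂ)) (t : ℝ) (g : G) :
    𝒢.coeff (α.aut t (𝒢.ofCc f)) g = factor α t g * f g := by
  have h1 := (exists_bump g isOpen_univ (mem_univ g)).choose_spec.1
  have h2 := hα.coeff_aut_mul hd f (exists_bump g isOpen_univ (mem_univ g)).choose t g
  rwa [h1, mul_one] at h2

theorem FixesUnits.coeff_aut (hα : FixesUnits α) (hd : Dense {g | 𝒢.TrivialIsotropy (𝒢.src g)})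
    (a : 𝒢.ReducedCStar) (t : ℝ) (g : G) :
    𝒢.coeff (α.aut t a) g = factor α t g * 𝒢.coeff a g := by
  refine 𝒢.eq_of_eq_ofCc (φ := fun a => 𝒢.coeffL g (α.aut t a))
    (χ := fun a => factor α t g * 𝒢.coeffL g a)
    ((𝒢.coeffL g).continuous.comp (continuous_aut_apply α t)) (by fun_prop) (fun f => ?_) a
  simp only [coeffL_apply, coeff_ofCc]
  exact hα.coeff_aut_ofCc hd f t g

/-- The bump chosen in `factor` need not vary continuously with g. Near g₀ the factor is instead the
quotient of the coefficient of α_t(f) by f, for one fixed bump f. -/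
theorem FixesUnits.continuous_factor (hα : FixesUnits α)
    (hd : Dense {g | 𝒢.TrivialIsotropy (𝒢.src g)}) :
    Continuous fun p : ℝ × G => factor α p.1 p.2 := by
  rw [continuous_iff_continuousAt]
  rintro ⟨t₀, g₀⟩
  obtain ⟨f, hf, -⟩ := exists_bump g₀ isOpen_univ (mem_univ g₀)
  have h1 : Continuous fun p : ℝ × G => 𝒢.coeff (α.aut p.1 (𝒢.ofCc f)) p.2 :=
    𝒢.continuous_coeff_uncurry.comp
      (((α.continuous_aut (𝒢.ofCc f)).comp continuous_fst).prodMk continuous_snd)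
  have h2 : Continuous fun p : ℝ × G => f p.2 := f.continuous.comp continuous_snd
  have h3 : f g₀ ≠ 0 := by rw [hf]; exact one_ne_zero
  refine (h1.continuousAt.div h2.continuousAt h3).congr ?_
  filter_upwards [h2.continuousAt.eventually_ne h3] with p hp
  rw [Pi.div_apply, hα.coeff_aut_ofCc hd, mul_div_cancel_right₀ _ hp]

/-- At a fixed arrow the factor is a continuous one-parameter group in t, bounded by the norm of a
bump because each α_t is isometric. -/
theorem FixesUnits.exists_factor_eq_exp (hα : FixesUnits α)
    (hd : Dense {g | 𝒢.TrivialIsotropy (𝒢.src g)}) :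
    ∃ c : C(G, ℝ), ∀ t g, factor α t g = Complex.exp (Complex.I * t * c g) := by
  have hcont := hα.continuous_factor hd
  have main : ∀ g, ∃ c : ℝ, ∀ t : ℝ, factor α t g = Complex.exp (Complex.I * t * c) := by
    intro g
    obtain ⟨f, hf, -⟩ := exists_bump g isOpen_univ (mem_univ g)
    have hval : ∀ t, 𝒢.coeff (α.aut t (𝒢.ofCc f)) g = factor α t g := fun t => by
      rw [hα.coeff_aut_ofCc hd, hf, mul_one]
    refine exists_eq_exp_of_continuous_add_eq_mul (C := ‖𝒢.ofCc f‖)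
      (hcont.comp (by fun_prop : Continuous fun t => (t, g))) ?_ (fun s t => ?_) (fun t => ?_)
    · rw [← hval, α.aut_zero, coeff_ofCc, hf]
    · rw [← hval, α.aut_add, hα.coeff_aut hd, hval]
    · rw [← hval, ← norm_aut α t]
      exact 𝒢.norm_coeff_le _ g
  choose c hc using main
  exact ⟨⟨c, continuous_exponent hcont fun t g => hc g t⟩, fun t g => hc g t⟩

/-- Compare both sides of α_t(f * k) = α_t(f) * α_t(k) at gh. With f supported on a bisection around
g, each convolution reduces to a single term, so the exponentials multiply. -/
theorem isHom_of_aut_eq_expMul {c : C(G, ℝ)}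
    (hc : ∀ (t : ℝ) (f : C_c(G, ℂ)), α.aut t (𝒢.ofCc f) = 𝒢.ofCc (expMul c t f)) : 𝒢.IsHom c := by
  intro g h hgh
  obtain ⟨V, hV, hgV, hr, -⟩ := 𝒢.exists_isOpen_bisection g
  obtain ⟨f, hf, -, hfV⟩ := exists_bump g hV hgV
  obtain ⟨k, hk, -⟩ := exists_bump h isOpen_univ (mem_univ h)
  refine eq_of_forall_exp_eq fun t => ?_
  have happ : ∀ (f : C_c(G, ℂ)) (g : G),
      expMul c t f g = Complex.exp (Complex.I * t * c g) * f g := fun _ _ => rfl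
  have h1 := congrArg (fun a => 𝒢.coeff a (𝒢.mul g h hgh)) (map_mul (α.aut t) (𝒢.ofCc f) (𝒢.ofCc k))
  simp only [← ofCc_conv, hc, coeff_ofCc] at h1
  rw [happ, 𝒢.conv_mul_apply hr hfV k g h hgh hgV, 𝒢.conv_mul_apply hr
    (fun g hg => hfV g (right_ne_zero_of_mul (a := Complex.exp (Complex.I * t * c g)) hg))
    _ g h hgh hgV, happ, happ, hf, hk, mul_one, mul_one, mul_one, mul_one, ← Complex.exp_add] at h1
  rw [h1]
  congr 1
  push_cast
  ring

end EtaleGroupoid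

/-! ### The main theorem -/

theorem mainTheorem8 {G : Type u} {X : Type v} [TopologicalSpace G] [TopologicalSpace X]
    [T2Space G] [LocallyCompactSpace G] [MeasurableSpace X] [BorelSpace X]
    (𝒢 : EtaleGroupoid G X)
    (htriv : ∃ x : X, 𝒢.TrivialIsotropy x)
    (hmin : 𝒢.IsMinimal)
    (α : OneParameterGroup 𝒢.ReducedCStar)
    (β : ℝ) (hβ : β ≠ 0)
    (hKMS : ∃ ψ : CStarWeight 𝒢.ReducedCStar, IsKMSWeight ψ α β ∧ 𝒢.IsDiagonalWeight ψ) :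
    ∃ c : C(G, ℝ), 𝒢.IsHom c ∧
      ∀ (t : ℝ) (f : C_c(G, ℂ)), α.aut t (𝒢.ofCc f) = 𝒢.ofCc (expMul c t f) := by
  obtain ⟨ψ, hψ, m, hreg, hm⟩ := hKMS
  have hm : 𝒢.IsWeightOf ψ m := hm
  have := EtaleGroupoid.isOpenPosMeasure_of_isKMSWeight hβ hψ hm hmin
  have hα : EtaleGroupoid.FixesUnits α := fun d hd t =>
    EtaleGroupoid.aut_ofCc_unit hβ hψ hm hd t
  have hd := 𝒢.dense_trivialIsotropy htriv hmin
  obtain ⟨c, hc⟩ := hα.exists_factor_eq_exp hd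
  have hexp : ∀ (t : ℝ) (f : C_c(G, ℂ)), α.aut t (𝒢.ofCc f) = 𝒢.ofCc (expMul c t f) := by
    intro t f
    refine 𝒢.ext_coeff fun g => ?_
    rw [hα.coeff_aut_ofCc hd, EtaleGroupoid.coeff_ofCc, hc]
    rfl
  exact ⟨c, EtaleGroupoid.isHom_of_aut_eq_expMul hexp, hexp⟩
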